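/- All curves are maps from $[0,1]$ to $\mathbb{R}^2$. For a smooth immersed curve $\gamma\in C^\infty([0,1];\mathbb{R}^2)$ let $\partial_s=|\gamma'|^{-1}\partial_x$ denote the arclength derivative and $ds=|\gamma'|\,dx$; let $L[\gamma]=\int_\gamma ds$ be its length, $\kappa=\partial_s^2\gamma$ its curvature vector, and $B[\gamma]=\int_\gamma|\kappa|^2\,ds$ its bending energy. Let $\theta[\gamma]$ be a continuous tangential angle, i.e. $\partial_s\gamma=(\cos\theta,\sin\theta)$, which is unique modulo $2\pi$; let $k[\gamma]=\partial_s\theta$ be the signed curvature and $TC[\gamma]=\int_\gamma k\,ds$ the total curvature. For a vector field $\psi$ along $\gamma$ put $\nabla_s\psi=\partial_s\psi-\langle\partial_s\psi,\partial_s\gamma\rangle\partial_s\gamma$. Let $\ell\in(0,1)$. An upper loop elastica $\gamma_{\mathrm{loop}}^{\ell,+}$ is a smooth curve of constant speed $1$ (hence of unit length) with $\gamma(0)=(0,0)$ and $\gamma(1)=(\ell,0)$ which, for some $\lambda\in\mathbb{R}$, solves $$-2\nabla_s^2\kappa-|\kappa|^2\kappa+\lambda\kappa=0\ \text{ on }[0,1],\qquad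 \kappa(0)=\kappa(1)=0,$$ whose image of $(0,1)$ lies in the open upper half-plane $\{(x,y):y>0\}$, and which has a tangential angle $\theta$ with $\theta(0)\in(0,\tfrac{\pi}{2})$, $\theta(1)\in(\tfrac{3\pi}{2},2\pi)$, and $\theta'>0$ on $(0,1)$. **Lemma (Well-prepared initial data).** For every $\ell\in(0,1)$ an upper loop elastica $\gamma_{\mathrm{loop}}^{\ell,+}$ exists, and for every such $\gamma_{\mathrm{loop}}^{\ell,+}$ there is an immersed curve $\gamma\in C^\infty([0,1];\mathbb{R}^2)$ with $L[\gamma]=1$, $\gamma(0)=(0,0)$, $\gamma(1)=(\ell,0)$ and a choice of tangential angle $\theta[\gamma]$ such that 1. $k[\gamma](0)=k[\gamma](1)=0$; 2. $\gamma((0,1))\subset\{(x,y):y>0\}$, $\theta[\gamma](0)\in(0,\tfrac{\pi}{2})$ and $\theta[\gamma](1)\in(\tfrac{3\pi}{2},2\pi)$; 3. $B[\gamma]<B[\gamma_{\mathrm{loop}}^{\ell,+}]$; 4. $TC[\gamma]>0$. -/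

import Mathlib

noncomputable section

namespace ElasticCurve

open scoped ContDiff

/-- The plane with its Euclidean norm and inner product. -/
abbrev Plane : Type := EuclideanSpace ℝ (Fin 2)

/-- The parameter interval `[0,1]`. A curve is a map `γ : ℝ → Plane` of which only the values on
this interval matter: all derivatives below are taken within it (so they are the one-sided ones
at `0` and at `1`). -/
abbrev I01 : Set ℝ := Set.Icc 0 1

/-- The velocity `γ'`. -/
def velocity (γ : ℝ → Plane) (x : ℝ) : Plane := derivWithin γ I01 x

/-- The arclength derivative `∂ₛψ = |γ'|⁻¹ ψ'` along the curve `γ`. -/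
def dArc {E : Type*} [NormedAddCommGroup E] [NormedSpace ℝ E] (γ : ℝ → Plane) (ψ : ℝ → E)
    (x : ℝ) : E :=
  ‖velocity γ x‖⁻¹ • derivWithin ψ I01 x

/-- The length `L[γ] = ∫_γ ds`. -/
def length (γ : ℝ → Plane) : ℝ := ∫ x in (0 : ℝ)..1, ‖velocity γ x‖

/-- The unit tangent `∂ₛγ`. -/
def tangent (γ : ℝ → Plane) : ℝ → Plane := dArc γ γ

/-- The curvature vector `κ = ∂ₛ²γ`. -/
def curvatureVector (γ : ℝ → Plane) : ℝ → Plane := dArc γ (tangent γ)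

/-- The bending energy `B[γ] = ∫_γ |κ|² ds`. -/
def bendingEnergy (γ : ℝ → Plane) : ℝ :=
  ∫ x in (0 : ℝ)..1, ‖curvatureVector γ x‖ ^ 2 * ‖velocity γ x‖

/-- The normal derivative `∇ₛψ = ∂ₛψ - ⟨∂ₛψ, ∂ₛγ⟩ ∂ₛγ` of a vector field along `γ`. -/
def normalDeriv (γ : ℝ → Plane) (ψ : ℝ → Plane) (x : ℝ) : Plane :=
  dArc γ ψ x - (inner ℝ (dArc γ ψ x) (tangent γ x)) • tangent γ x

/-- `γ ∈ A_ℓ ∩ C^∞([0,1]; ℝ²)`: a smooth immersed curve of unit length from `(0,0)` to `(ℓ,0)`.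
(Smoothness up to the endpoints of a bounded interval contains `H²`-regularity, and on a compact
interval a continuous nowhere vanishing `γ'` has `min |γ'| > 0`.) -/
structure IsSmoothAdmissible (ℓ : ℝ) (γ : ℝ → Plane) : Prop where
  smooth : ContDiffOn ℝ ∞ γ I01
  immersed : ∀ x ∈ I01, velocity γ x ≠ 0
  start_eq : γ 0 = !₂[0, 0]
  end_eq : γ 1 = !₂[ℓ, 0]
  length_eq : length γ = 1

/-- `θ` is a tangential angle function of `γ`: continuous on `[0,1]` with
`∂ₛγ = (cos θ, sin θ)`. It is unique up to an additive constant in `2πℤ`. -/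
structure IsTangentAngle (γ : ℝ → Plane) (θ : ℝ → ℝ) : Prop where
  continuousOn : ContinuousOn θ I01
  tangent_eq : ∀ x ∈ I01, tangent γ x = !₂[Real.cos (θ x), Real.sin (θ x)]

/-- The signed curvature `k = ∂ₛθ`, where `θ` is a tangential angle of `γ`. -/
def signedCurvature (γ : ℝ → Plane) (θ : ℝ → ℝ) : ℝ → ℝ := dArc γ θ

/-- The total signed curvature `TC[γ] = ∫_γ k ds`, where `θ` is a tangential angle of `γ`. -/
def totalCurvature (γ : ℝ → Plane) (θ : ℝ → ℝ) : ℝ :=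
  ∫ x in (0 : ℝ)..1, signedCurvature γ θ x * ‖velocity γ x‖

/-- The open upper half-plane. -/
def upperHalf : Set Plane := {p | 0 < p 1}

/-- `γ` is, for some multiplier `lam`, a solution of the equation of critical points of the bending
energy at fixed length, `-2∇ₛ²κ - |κ|²κ + lam κ = 0`, with vanishing curvature at both ends. -/
def IsCritical (γ : ℝ → Plane) : Prop :=
  (∃ lam : ℝ, ∀ x ∈ I01,
    -(2 : ℝ) • normalDeriv γ (normalDeriv γ (curvatureVector γ)) x
      - ‖curvatureVector γ x‖ ^ 2 • curvatureVector γ x + lam • curvatureVector γ x = 0) ∧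
  curvatureVector γ 0 = 0 ∧ curvatureVector γ 1 = 0

/-- `γ` is the upper loop elastica `γ_loop^{ℓ,+}`: the critical point among the unit-length curves
from `(0,0)` to `(ℓ,0)`, parameterized with constant speed (equal to the length, that is, to `1`),
that runs in the open upper half-plane and whose tangential angle increases strictly from a value
in `(0, π/2)` to a value in `(3π/2, 2π)`. -/
def IsUpperLoop (ℓ : ℝ) (γ : ℝ → Plane) : Prop :=
  IsSmoothAdmissible ℓ γ ∧
  (∀ x ∈ I01, ‖velocity γ x‖ = 1) ∧
  IsCritical γ ∧
  Set.MapsTo γ (Set.Ioo 0 1) upperHalf ∧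
  ∃ θ : ℝ → ℝ, IsTangentAngle γ θ ∧
    θ 0 ∈ Set.Ioo 0 (Real.pi / 2) ∧
    θ 1 ∈ Set.Ioo (3 * Real.pi / 2) (2 * Real.pi) ∧
    ∀ x ∈ Set.Ioo (0 : ℝ) 1, 0 < derivWithin θ I01 x

end ElasticCurve

end

noncomputable section

namespace ElasticCurve

open scoped ContDiff

/-! All curves are written by arclength through their direction `θ`, so that the bending energy is
`∫ θ'²` and the end conditions are `∫ cos θ = ℓ`, `∫ sin θ = 0`.

Existence: `θ = π + 2 arcsin (√m sin v)` with `v' = C √(1 - m sin² v)`, where `v` runs from `-π/2`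
to `π/2`, solves the pendulum equation `θ'' = C² sin θ`. The chord condition fixes `m` by the
intermediate value theorem (`exists_modulus`): the chord is negative at `m = 1/2`, and tends to the
full length as the elliptic integral diverges at `m → 1`.

Competitor: every loop satisfies `k' = c sin θ` with `c > 0` (`exists_pendulum`). The field `k`
solves the linearized equation `k'' = c cos θ k` and vanishes at the ends, so `∫ (k'² + c cos θ k²)
= 0`. Only the length of the chord has to be kept, since the curve can be turned afterwards. The
vertical drift `M = ∫ cos θ k = sin θ(1) - sin θ(0) ≠ 0` then adds a term of sign `-c M² / ℓ`, and
`k` becomes a direction of negative second variation. Moving `θ` along `k` would spoil the zero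
curvature at the ends, so `k` is replaced by `φ = √(k² + η²)`, whose derivative `k k' / φ` vanishes
there; the second variation stays negative because `ℓ < 1` (`exists_unstable`).

The deformed direction is `π + t (θ - π) + ε φ`. Its energy is `t² ∫ k² + ε² ∫ φ'²`, without cross
term. For small `ε` some `t < 1 - σ ε²` restores the chord length, and this `t` is small enough to
lower the energy (`exists_param`). The curvature stays positive inside, so the direction increases;
as the ends have equal height, the curve stays above the axis (`integral_sin_pos`). -/

/-! ### Calculus on the unit interval -/

theorem uniqueDiffOn_I01 : UniqueDiffOn ℝ I01 := uniqueDiffOn_Icc zero_lt_one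

theorem uniqueDiffWithinAt_I01 {x : ℝ} (hx : x ∈ I01) : UniqueDiffWithinAt ℝ I01 x :=
  uniqueDiffOn_I01 x hx

/-- A primitive vanishing at `0` of a continuous function on the unit interval. -/
def primitive (f : ℝ → ℝ) (x : ℝ) : ℝ := ∫ s in (0 : ℝ)..x, f (Set.projIcc 0 1 zero_le_one s)

theorem primitive_zero (f : ℝ → ℝ) : primitive f 0 = 0 := by simp [primitive]

theorem hasDerivWithinAt_primitive {f : ℝ → ℝ} (hf : ContinuousOn f I01) {x : ℝ} (hx : x ∈ I01) :
    HasDerivWithinAt (primitive f) (f x) I01 x := by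
  have hc : Continuous fun s : ℝ => f (Set.projIcc 0 1 zero_le_one s) :=
    (continuousOn_iff_continuous_domRestrict.1 hf).comp continuous_projIcc
  have h := (hc.integral_hasStrictDerivAt 0 x).hasDerivAt
  simp only [Set.projIcc_of_mem zero_le_one hx] at h
  exact h.hasDerivWithinAt

theorem continuousOn_of_hasDerivWithinAt {E : Type*} [NormedAddCommGroup E] [NormedSpace ℝ E]
    {F f : ℝ → E} (h : ∀ x ∈ I01, HasDerivWithinAt F (f x) I01 x) : ContinuousOn F I01 :=
  fun x hx => (h x hx).continuousWithinAt

theorem integral_eq_sub_of_hasDerivWithinAt {F f : ℝ → ℝ}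
    (h : ∀ x ∈ I01, HasDerivWithinAt F (f x) I01 x) (hf : ContinuousOn f I01) :
    ∀ x ∈ I01, ∫ s in (0 : ℝ)..x, f s = F x - F 0 := by
  intro x hx
  have hsub : Set.Icc 0 x ⊆ I01 := Set.Icc_subset_Icc le_rfl hx.2
  refine intervalIntegral.integral_eq_sub_of_hasDerivAt_of_le hx.1
    ((continuousOn_of_hasDerivWithinAt h).mono hsub) (fun y hy => ?_)
    ((hf.mono hsub).intervalIntegrable_of_Icc hx.1)
  exact (h y ⟨hy.1.le, hy.2.le.trans hx.2⟩).hasDerivAt (Icc_mem_nhds hy.1 (hy.2.trans_le hx.2))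

theorem contDiffOn_of_hasDerivWithinAt {E : Type*} [NormedAddCommGroup E] [NormedSpace ℝ E]
    {F f : ℝ → E} (h : ∀ x ∈ I01, HasDerivWithinAt F (f x) I01 x)
    (hf : ContDiffOn ℝ ∞ f I01) : ContDiffOn ℝ ∞ F I01 := by
  rw [contDiffOn_infty_iff_derivWithin uniqueDiffOn_I01]
  exact ⟨fun x hx => (h x hx).differentiableWithinAt,
    hf.congr fun x hx => (h x hx).derivWithin (uniqueDiffWithinAt_I01 hx)⟩

theorem contDiffOn_derivWithin {E : Type*} [NormedAddCommGroup E] [NormedSpace ℝ E]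
    {F : ℝ → E} (h : ContDiffOn ℝ ∞ F I01) : ContDiffOn ℝ ∞ (derivWithin F I01) I01 :=
  ((contDiffOn_infty_iff_derivWithin uniqueDiffOn_I01).1 h).2

theorem hasDerivWithinAt_derivWithin {E : Type*} [NormedAddCommGroup E] [NormedSpace ℝ E]
    {F : ℝ → E} (h : ContDiffOn ℝ ∞ F I01) {x : ℝ} (hx : x ∈ I01) :
    HasDerivWithinAt F (derivWithin F I01 x) I01 x :=
  (h.differentiableOn (by simp) x hx).hasDerivWithinAt

theorem strictMonoOn_of_hasDerivWithinAt_pos {F f : ℝ → ℝ}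
    (h : ∀ x ∈ I01, HasDerivWithinAt F (f x) I01 x) (hpos : ∀ x ∈ Set.Ioo (0 : ℝ) 1, 0 < f x) :
    StrictMonoOn F I01 := by
  refine strictMonoOn_of_deriv_pos (convex_Icc 0 1) (continuousOn_of_hasDerivWithinAt h)
    fun x hx => ?_
  rw [interior_Icc] at hx
  rw [((h x ⟨hx.1.le, hx.2.le⟩).hasDerivAt (Icc_mem_nhds hx.1 hx.2)).deriv]
  exact hpos x hx

/-! ### Arclength parametrized curves and their direction -/

/-- The unit vector of direction `a`. -/
def unitVec (a : ℝ) : Plane := !₂[Real.cos a, Real.sin a]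

/-- The unit vector of direction `a`, turned counterclockwise by a right angle. -/
def unitNormal (a : ℝ) : Plane := !₂[-Real.sin a, Real.cos a]

theorem norm_unitVec (a : ℝ) : ‖unitVec a‖ = 1 := by
  simp [unitVec, EuclideanSpace.norm_eq]

theorem norm_unitNormal (a : ℝ) : ‖unitNormal a‖ = 1 := by
  simp [unitNormal, EuclideanSpace.norm_eq]

theorem hasDerivWithinAt_plane {f g : ℝ → ℝ} {f' g' : ℝ} {s : Set ℝ} {x : ℝ}
    (hf : HasDerivWithinAt f f' s x) (hg : HasDerivWithinAt g g' s x) :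
    HasDerivWithinAt (fun y => (!₂[f y, g y] : Plane)) !₂[f', g'] s x := by
  have h : HasDerivWithinAt (fun y => ![f y, g y]) ![f', g'] s x := by
    rw [hasDerivWithinAt_pi]
    intro i
    fin_cases i
    · simpa using hf
    · simpa using hg
  exact (PiLp.continuousLinearEquiv 2 ℝ fun _ : Fin 2 => ℝ).symm.hasFDerivAt.comp_hasDerivWithinAt
    x h

theorem hasDerivWithinAt_apply {γ : ℝ → Plane} {v : Plane} {s : Set ℝ} {x : ℝ}
    (h : HasDerivWithinAt γ v s x) (i : Fin 2) : HasDerivWithinAt (fun y => γ y i) (v i) s x :=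
  (PiLp.proj (𝕜 := ℝ) 2 (fun _ : Fin 2 => ℝ) i).hasFDerivAt.comp_hasDerivWithinAt x h

theorem hasDerivWithinAt_unitVec {θ : ℝ → ℝ} {k : ℝ} {s : Set ℝ} {x : ℝ}
    (h : HasDerivWithinAt θ k s x) :
    HasDerivWithinAt (fun y => unitVec (θ y)) (k • unitNormal (θ x)) s x := by
  have e : k • unitNormal (θ x) = !₂[-Real.sin (θ x) * k, Real.cos (θ x) * k] := by
    ext i; fin_cases i <;> simp [unitNormal, mul_comm]
  rw [e]
  exact hasDerivWithinAt_plane h.cos h.sin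

theorem hasDerivWithinAt_unitNormal {θ : ℝ → ℝ} {k : ℝ} {s : Set ℝ} {x : ℝ}
    (h : HasDerivWithinAt θ k s x) :
    HasDerivWithinAt (fun y => unitNormal (θ y)) (-k • unitVec (θ x)) s x := by
  have e : -k • unitVec (θ x) = !₂[-(Real.cos (θ x) * k), -Real.sin (θ x) * k] := by
    ext i; fin_cases i <;> simp [unitVec, mul_comm]
  rw [e]
  exact hasDerivWithinAt_plane h.sin.neg h.cos

/-- `γ` is parametrized by arclength on the unit interval, with direction `θ`. -/
def HasDirection (γ : ℝ → Plane) (θ : ℝ → ℝ) : Prop :=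
  ∀ x ∈ I01, HasDerivWithinAt γ (unitVec (θ x)) I01 x

namespace HasDirection

variable {γ : ℝ → Plane} {θ k k₁ k₂ : ℝ → ℝ}

theorem velocity_eq (h : HasDirection γ θ) {x : ℝ} (hx : x ∈ I01) :
    velocity γ x = unitVec (θ x) :=
  (h x hx).derivWithin (uniqueDiffWithinAt_I01 hx)

theorem norm_velocity (h : HasDirection γ θ) {x : ℝ} (hx : x ∈ I01) : ‖velocity γ x‖ = 1 := by
  rw [h.velocity_eq hx, norm_unitVec]

theorem dArc_eq (h : HasDirection γ θ) {E : Type*} [NormedAddCommGroup E] [NormedSpace ℝ E]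
    {ψ ψ₀ : ℝ → E} {v : E} {x : ℝ} (hx : x ∈ I01) (hψ : Set.EqOn ψ ψ₀ I01)
    (hd : HasDerivWithinAt ψ₀ v I01 x) : dArc γ ψ x = v := by
  rw [dArc, h.norm_velocity hx, inv_one, one_smul, derivWithin_congr hψ (hψ hx),
    hd.derivWithin (uniqueDiffWithinAt_I01 hx)]

theorem tangent_eq (h : HasDirection γ θ) : Set.EqOn (tangent γ) (fun x => unitVec (θ x)) I01 :=
  fun x hx => h.dArc_eq hx (fun _ _ => rfl) (h x hx)

theorem curvatureVector_eq (h : HasDirection γ θ)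
    (hθ : ∀ x ∈ I01, HasDerivWithinAt θ (k x) I01 x) :
    Set.EqOn (curvatureVector γ) (fun x => k x • unitNormal (θ x)) I01 :=
  fun x hx => h.dArc_eq hx h.tangent_eq (hasDerivWithinAt_unitVec (hθ x hx))

/-- The unit normal has a purely tangential derivative, which the projection removes. Hence the
normal derivative acts on the coefficient alone, and the elastica equation becomes scalar. -/
theorem normalDeriv_eq (h : HasDirection γ θ)
    (hθ : ∀ x ∈ I01, HasDerivWithinAt θ (k x) I01 x) {ψ : ℝ → Plane} {a a₁ : ℝ → ℝ}
    (ha : ∀ x ∈ I01, HasDerivWithinAt a (a₁ x) I01 x)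
    (hψ : Set.EqOn ψ (fun x => a x • unitNormal (θ x)) I01) :
    Set.EqOn (normalDeriv γ ψ) (fun x => a₁ x • unitNormal (θ x)) I01 := by
  intro x hx
  have hd := h.dArc_eq hx hψ ((ha x hx).smul (hasDerivWithinAt_unitNormal (hθ x hx)))
  simp only [normalDeriv, hd, h.tangent_eq hx]
  ext i
  have := Real.sin_sq_add_cos_sq (θ x)
  fin_cases i
  · simp [unitVec, unitNormal, PiLp.inner_apply, Fin.sum_univ_two]
    linear_combination (a x * k x * Real.cos (θ x)) * this
  · simp [unitVec, unitNormal, PiLp.inner_apply, Fin.sum_univ_two]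
    linear_combination (a x * k x * Real.sin (θ x)) * this

theorem isTangentAngle (h : HasDirection γ θ) (hθ : ContinuousOn θ I01) : IsTangentAngle γ θ :=
  ⟨hθ, fun _ hx => h.tangent_eq hx⟩

theorem length_eq (h : HasDirection γ θ) : length γ = 1 := by
  have : length γ = ∫ _ in (0 : ℝ)..1, (1 : ℝ) := by
    refine intervalIntegral.integral_congr fun x hx => ?_
    rw [Set.uIcc_of_le zero_le_one] at hx
    exact h.norm_velocity hx
  simpa using this

theorem bendingEnergy_eq (h : HasDirection γ θ)
    (hθ : ∀ x ∈ I01, HasDerivWithinAt θ (k x) I01 x) :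
    bendingEnergy γ = ∫ x in (0 : ℝ)..1, k x ^ 2 := by
  refine intervalIntegral.integral_congr fun x hx => ?_
  rw [Set.uIcc_of_le zero_le_one] at hx
  simp only [h.norm_velocity hx, h.curvatureVector_eq hθ hx, norm_smul, norm_unitNormal]
  simp

theorem signedCurvature_eq (h : HasDirection γ θ)
    (hθ : ∀ x ∈ I01, HasDerivWithinAt θ (k x) I01 x) : Set.EqOn (signedCurvature γ θ) k I01 :=
  fun x hx => h.dArc_eq hx (fun _ _ => rfl) (hθ x hx)

theorem totalCurvature_eq (h : HasDirection γ θ)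
    (hθ : ∀ x ∈ I01, HasDerivWithinAt θ (k x) I01 x) (hk : ContinuousOn k I01) :
    totalCurvature γ θ = θ 1 - θ 0 := by
  rw [← integral_eq_sub_of_hasDerivWithinAt hθ hk 1 (by simp)]
  refine intervalIntegral.integral_congr fun x hx => ?_
  rw [Set.uIcc_of_le zero_le_one] at hx
  simp only [h.norm_velocity hx, h.signedCurvature_eq hθ hx, mul_one]

theorem elastica_expression_eq (h : HasDirection γ θ)
    (hθ : ∀ x ∈ I01, HasDerivWithinAt θ (k x) I01 x)
    (hk : ∀ x ∈ I01, HasDerivWithinAt k (k₁ x) I01 x)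
    (hk₁ : ∀ x ∈ I01, HasDerivWithinAt k₁ (k₂ x) I01 x) (lam : ℝ) {x : ℝ} (hx : x ∈ I01) :
    -(2 : ℝ) • normalDeriv γ (normalDeriv γ (curvatureVector γ)) x
      - ‖curvatureVector γ x‖ ^ 2 • curvatureVector γ x + lam • curvatureVector γ x
      = (-2 * k₂ x - k x ^ 3 + lam * k x) • unitNormal (θ x) := by
  have hc := h.curvatureVector_eq hθ
  rw [h.normalDeriv_eq hθ hk₁ (h.normalDeriv_eq hθ hk hc) hx, hc hx]
  simp only [norm_smul, norm_unitNormal, mul_one, Real.norm_eq_abs, sq_abs, smul_smul]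
  rw [← sub_smul, ← add_smul]
  ring_nf

theorem isCritical_iff (h : HasDirection γ θ)
    (hθ : ∀ x ∈ I01, HasDerivWithinAt θ (k x) I01 x)
    (hk : ∀ x ∈ I01, HasDerivWithinAt k (k₁ x) I01 x)
    (hk₁ : ∀ x ∈ I01, HasDerivWithinAt k₁ (k₂ x) I01 x) :
    IsCritical γ ↔
      (∃ lam : ℝ, ∀ x ∈ I01, -2 * k₂ x - k x ^ 3 + lam * k x = 0) ∧ k 0 = 0 ∧ k 1 = 0 := by
  have hn : ∀ a, unitNormal a ≠ 0 := fun a => norm_ne_zero_iff.1 (by simp [norm_unitNormal])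
  have hc := h.curvatureVector_eq hθ
  rw [IsCritical, hc (by simp : (0 : ℝ) ∈ I01), hc (by simp : (1 : ℝ) ∈ I01)]
  simp only [smul_eq_zero, hn, or_false]
  refine and_congr_left fun _ => exists_congr fun lam => forall₂_congr fun x hx => ?_
  rw [h.elastica_expression_eq hθ hk hk₁ lam hx]
  simp [hn]

theorem apply_zero (h : HasDirection γ θ) (hθ : ContinuousOn θ I01) {x : ℝ} (hx : x ∈ I01) :
    ∫ s in (0 : ℝ)..x, Real.cos (θ s) = γ x 0 - γ 0 0 :=
  integral_eq_sub_of_hasDerivWithinAt (fun y hy => hasDerivWithinAt_apply (h y hy) 0)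
    (Real.continuous_cos.comp_continuousOn hθ) x hx

theorem apply_one (h : HasDirection γ θ) (hθ : ContinuousOn θ I01) {x : ℝ} (hx : x ∈ I01) :
    ∫ s in (0 : ℝ)..x, Real.sin (θ s) = γ x 1 - γ 0 1 :=
  integral_eq_sub_of_hasDerivWithinAt (fun y hy => hasDerivWithinAt_apply (h y hy) 1)
    (Real.continuous_sin.comp_continuousOn hθ) x hx

end HasDirection

/-- The arclength parametrized curve with direction `θ` that starts at the origin. -/
def curveOfAngle (θ : ℝ → ℝ) (x : ℝ) : Plane :=
  !₂[primitive (fun s => Real.cos (θ s)) x, primitive (fun s => Real.sin (θ s)) x]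

theorem hasDirection_curveOfAngle {θ : ℝ → ℝ} (hθ : ContinuousOn θ I01) :
    HasDirection (curveOfAngle θ) θ := fun _ hx =>
  hasDerivWithinAt_plane
    (hasDerivWithinAt_primitive (Real.continuous_cos.comp_continuousOn hθ) hx)
    (hasDerivWithinAt_primitive (Real.continuous_sin.comp_continuousOn hθ) hx)

theorem curveOfAngle_zero (θ : ℝ → ℝ) : curveOfAngle θ 0 = !₂[0, 0] := by
  simp [curveOfAngle, primitive_zero]

theorem curveOfAngle_apply_one {θ : ℝ → ℝ} (hθ : ContinuousOn θ I01) {x : ℝ} (hx : x ∈ I01) :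
    curveOfAngle θ x 1 = ∫ s in (0 : ℝ)..x, Real.sin (θ s) := by
  rw [(hasDirection_curveOfAngle hθ).apply_one hθ hx, curveOfAngle_zero]
  simp

theorem isSmoothAdmissible_curveOfAngle {θ : ℝ → ℝ} {ℓ : ℝ} (hθ : ContDiffOn ℝ ∞ θ I01)
    (hc : ∫ s in (0 : ℝ)..1, Real.cos (θ s) = ℓ) (hs : ∫ s in (0 : ℝ)..1, Real.sin (θ s) = 0) :
    IsSmoothAdmissible ℓ (curveOfAngle θ) := by
  have hd := hasDirection_curveOfAngle hθ.continuousOn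
  have h1 : (1 : ℝ) ∈ I01 := by simp
  refine ⟨contDiffOn_of_hasDerivWithinAt hd ?_, fun x hx => ?_, curveOfAngle_zero θ, ?_,
    hd.length_eq⟩
  · rw [contDiffOn_euclidean]
    intro i
    fin_cases i
    · exact Real.contDiff_cos.comp_contDiffOn hθ
    · exact Real.contDiff_sin.comp_contDiffOn hθ
  · rw [← norm_ne_zero_iff, hd.norm_velocity hx]
    exact one_ne_zero
  · have e0 := hd.apply_zero hθ.continuousOn h1
    have e1 := hd.apply_one hθ.continuousOn h1
    rw [hc, curveOfAngle_zero] at e0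
    rw [hs, curveOfAngle_zero] at e1
    ext i
    fin_cases i
    · simpa using e0.symm
    · simpa using e1.symm

/-- A curve whose direction increases from `(0, π)` to `(π, 2π)` and whose ends have the same
height runs above its ends. -/
theorem integral_sin_pos {θ : ℝ → ℝ} (hθ : ContinuousOn θ I01) (hmono : StrictMonoOn θ I01)
    (h0 : 0 ≤ θ 0) (h1 : θ 1 ≤ 2 * Real.pi)
    (hs : ∫ s in (0 : ℝ)..1, Real.sin (θ s) = 0) {x : ℝ} (hx : x ∈ Set.Ioo (0 : ℝ) 1) :
    0 < ∫ s in (0 : ℝ)..x, Real.sin (θ s) := by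
  have hc : ContinuousOn (fun s => Real.sin (θ s)) I01 := Real.continuous_sin.comp_continuousOn hθ
  have hxI : x ∈ I01 := ⟨hx.1.le, hx.2.le⟩
  have hsub0 : Set.Icc 0 x ⊆ I01 := Set.Icc_subset_Icc le_rfl hx.2.le
  have hsub1 : Set.Icc x 1 ⊆ I01 := Set.Icc_subset_Icc hx.1.le le_rfl
  have i0 := (hc.mono hsub0).intervalIntegrable_of_Icc hx.1.le (μ := MeasureTheory.volume)
  have i1 := (hc.mono hsub1).intervalIntegrable_of_Icc hx.2.le (μ := MeasureTheory.volume)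
  -- Up to direction `π` the height has only grown. Beyond it the height falls strictly to its final
  -- value `0`, hence is still positive.
  rcases le_total (θ x) Real.pi with hle | hle
  · refine intervalIntegral.intervalIntegral_pos_of_pos_on i0 (fun s hsx => ?_) hx.1
    have hsI : s ∈ I01 := ⟨hsx.1.le, hsx.2.le.trans hx.2.le⟩
    exact Real.sin_pos_of_pos_of_lt_pi (h0.trans_lt (hmono (by simp) hsI hsx.1))
      ((hmono hsI hxI hsx.2).trans_le hle)
  · have hneg : 0 < ∫ s in x..1, -Real.sin (θ s) := by
      refine intervalIntegral.intervalIntegral_pos_of_pos_on i1.neg (fun s hsx => ?_) hx.2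
      have hsI : s ∈ I01 := ⟨hx.1.le.trans hsx.1.le, hsx.2.le⟩
      have a := hle.trans_lt (hmono hxI hsI hsx.1)
      have b := (hmono hsI (by simp) hsx.2).trans_le h1
      have := Real.sin_pos_of_pos_of_lt_pi (x := θ s - Real.pi) (by linarith) (by linarith)
      rwa [Real.sin_sub_pi] at this
    rw [intervalIntegral.integral_neg] at hneg
    have := intervalIntegral.integral_add_adjacent_intervals i0 i1
    rw [hs] at this
    linarith

/-- A tangential angle of an arclength parametrized smooth curve is smooth. -/
theorem contDiffOn_angle {θ : ℝ → ℝ} (hθ : ContinuousOn θ I01)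
    (hc : ContDiffOn ℝ ∞ (fun x => Real.cos (θ x)) I01)
    (hs : ContDiffOn ℝ ∞ (fun x => Real.sin (θ x)) I01) : ContDiffOn ℝ ∞ θ I01 := by
  intro x hx
  have hsm : ContDiffWithinAt ℝ ∞ (fun y => Real.sin (θ y - θ x)) I01 x := by
    simp only [Real.sin_sub]
    exact ((hs x hx).mul contDiffWithinAt_const).sub ((hc x hx).mul contDiffWithinAt_const)
  -- Near `x` this function is `θ`, because continuity keeps `θ y - θ x` within the range where
  -- `arcsin` inverts the sine.
  have hg : ContDiffWithinAt ℝ ∞ (fun y => θ x + Real.arcsin (Real.sin (θ y - θ x))) I01 x := by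
    have ha : ContDiffAt ℝ ∞ Real.arcsin (Real.sin (θ x - θ x)) :=
      Real.contDiffAt_arcsin (by simp) (by simp)
    exact contDiffWithinAt_const.add 
      (ContDiffAt.comp_contDiffWithinAt (g := Real.arcsin) (f := fun y => Real.sin (θ y - θ x)) x ha
        hsm)
  have hpi := Real.pi_pos
  have hnear : ∀ᶠ y in nhdsWithin x I01, θ y - θ x ∈ Set.Ioo (-(Real.pi / 2)) (Real.pi / 2) := by
    have ht : ContinuousWithinAt (fun y => θ y - θ x) I01 x :=
      (hθ x hx).sub continuousWithinAt_const
    refine ht.eventually (Ioo_mem_nhds ?_ ?_) <;> simp <;> linarith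
  refine hg.congr_of_eventuallyEq ?_ (by simp)
  filter_upwards [hnear] with y hy
  rw [Real.arcsin_sin hy.1.le hy.2.le]
  ring

/-! ### Elliptic integrals and existence of the loop -/

/-- Jacobi's delta amplitude `√(1 - m sin² u)`, of parameter `m`. -/
def deltaAmp (m u : ℝ) : ℝ := √(1 - m * Real.sin u ^ 2)

theorem one_sub_mul_sin_sq_pos {m : ℝ} (hm : m < 1) (u : ℝ) : 0 < 1 - m * Real.sin u ^ 2 := by
  rcases le_total 0 m with h | h <;>
    nlinarith [Real.sin_sq_le_one u, sq_nonneg (Real.sin u)]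

theorem deltaAmp_pos {m : ℝ} (hm : m < 1) (u : ℝ) : 0 < deltaAmp m u :=
  Real.sqrt_pos.2 (one_sub_mul_sin_sq_pos hm u)

theorem deltaAmp_sq {m : ℝ} (hm : m < 1) (u : ℝ) :
    deltaAmp m u ^ 2 = 1 - m * Real.sin u ^ 2 :=
  Real.sq_sqrt (one_sub_mul_sin_sq_pos hm u).le

theorem deltaAmp_le_one {m : ℝ} (hm : 0 ≤ m) (u : ℝ) : deltaAmp m u ≤ 1 := by
  refine Real.sqrt_le_one.2 ?_
  nlinarith [mul_nonneg hm (sq_nonneg (Real.sin u))]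

theorem continuous_deltaAmp (m : ℝ) : Continuous (deltaAmp m) := by
  unfold deltaAmp; fun_prop

theorem continuous_div_deltaAmp {m : ℝ} (hm : m < 1) {f : ℝ → ℝ} (hf : Continuous f) :
    Continuous fun u => f u / deltaAmp m u :=
  hf.div (continuous_deltaAmp m) fun u => (deltaAmp_pos hm u).ne'

/-- With `m = 1 - q²` the radicand is `cos² u + q² sin² u`, at most `(π/2 - u + q)²` on `[0, π/2]`.
The logarithmic divergence as `q → 0` makes the chord approach the full length. -/
theorem neg_log_le_integral_deltaAmp {q : ℝ} (hq : 0 < q) (hq1 : q < 1) :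
    -Real.log q ≤ ∫ u in (-(Real.pi / 2))..(Real.pi / 2), 1 / deltaAmp (1 - q ^ 2) u := by
  have hpi := Real.pi_gt_three
  have hm : 1 - q ^ 2 < 1 := by nlinarith
  have hc := continuous_div_deltaAmp hm (continuous_const (y := (1 : ℝ)))
  have hi : ∀ a b, IntervalIntegrable (fun u => 1 / deltaAmp (1 - q ^ 2) u)
    MeasureTheory.volume a b := fun a b => hc.intervalIntegrable a b
  have hpos : ∀ u, 0 ≤ 1 / deltaAmp (1 - q ^ 2) u := fun u =>
    (one_div_pos.2 (deltaAmp_pos hm u)).le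
  have hle : ∀ u ∈ Set.Icc 0 (Real.pi / 2),
      (Real.pi / 2 - u + q)⁻¹ ≤ 1 / deltaAmp (1 - q ^ 2) u := by
    intro u hu
    rw [one_div]
    refine inv_anti₀ (deltaAmp_pos hm u) (Real.sqrt_le_iff.2 ⟨by linarith [hu.2], ?_⟩)
    have h1 : Real.cos u ≤ Real.pi / 2 - u := by
      rw [← Real.sin_pi_div_two_sub]
      exact Real.sin_le (by linarith [hu.2])
    have h2 : 0 ≤ Real.cos u := Real.cos_nonneg_of_mem_Icc ⟨by linarith [hu.1], hu.2⟩
    have h3 := Real.sin_sq_add_cos_sq u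
    have h4 : Real.cos u ^ 2 ≤ (Real.pi / 2 - u) ^ 2 := by gcongr
    have h5 : 0 ≤ (Real.pi / 2 - u) * q := mul_nonneg (by linarith) hq.le
    nlinarith [mul_nonneg (sq_nonneg q) (sq_nonneg (Real.cos u))]
  have hd : ∀ u ∈ Set.uIcc 0 (Real.pi / 2), HasDerivAt (fun u => -Real.log (Real.pi / 2 - u + q))
      (Real.pi / 2 - u + q)⁻¹ u := by
    intro u hu
    rw [Set.uIcc_of_le (by linarith)] at hu
    have h0 : Real.pi / 2 - u + q ≠ 0 := by linarith [hu.2]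
    exact ((((hasDerivAt_id' u).const_sub (Real.pi / 2)).add_const q).log h0).neg.congr_deriv
      (by rw [neg_div, neg_neg, one_div])
  have hcl : ContinuousOn (fun u => (Real.pi / 2 - u + q)⁻¹) (Set.uIcc 0 (Real.pi / 2)) := by
    refine ContinuousOn.inv₀ (by fun_prop) fun u hu => ?_
    rw [Set.uIcc_of_le (by linarith)] at hu
    linarith [hu.2]
  have hint := intervalIntegral.integral_eq_sub_of_hasDerivAt hd hcl.intervalIntegrable
  have hmono := intervalIntegral.integral_mono_on (by linarith) hcl.intervalIntegrable
    (hi 0 (Real.pi / 2)) hle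
  rw [hint] at hmono
  have hsplit := intervalIntegral.integral_add_adjacent_intervals (hi (-(Real.pi / 2)) 0)
    (hi 0 (Real.pi / 2))
  have hleft : 0 ≤ ∫ u in (-(Real.pi / 2))..0, 1 / deltaAmp (1 - q ^ 2) u :=
    intervalIntegral.integral_nonneg (by linarith) fun u _ => hpos u
  have hlog : 0 ≤ Real.log (Real.pi / 2 - 0 + q) := Real.log_nonneg (by linarith)
  simp only [sub_self, zero_add] at hmono
  linarith

/-- The parameter of the loop elastica whose ends are at distance `ℓ`. -/
theorem exists_modulus {ℓ : ℝ} (hℓ : ℓ ∈ Set.Ioo (0 : ℝ) 1) :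
    ∃ m ∈ Set.Ioo (1 / 2 : ℝ) 1,
      ∫ u in (-(Real.pi / 2))..(Real.pi / 2), (2 * m * Real.sin u ^ 2 - 1) / deltaAmp m u =
        ℓ * ∫ u in (-(Real.pi / 2))..(Real.pi / 2), 1 / deltaAmp m u := by
  have hpi := Real.pi_gt_three
  have hℓ1 : 0 < 1 - ℓ := by linarith [hℓ.2]
  -- Chosen so that `(1 - ℓ) N` exceeds `2π`, the integral of the error `2` over an interval of
  -- length `π`.
  set N : ℝ := 2 * Real.pi / (1 - ℓ) + 1 with hN
  have hN1 : 1 < N := by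
    have : 0 < 2 * Real.pi / (1 - ℓ) := by positivity
    linarith
  set q : ℝ := Real.exp (-N) with hq
  have hq0 : 0 < q := Real.exp_pos _
  have hq2 : q < 1 / 2 := by
    have h1 := Real.add_one_le_exp N
    rw [hq, Real.exp_neg, one_div]
    exact inv_strictAnti₀ (by norm_num) (by linarith)
  set m₁ : ℝ := 1 - q ^ 2 with hm₁
  have hm1 : m₁ < 1 := by nlinarith
  have hm2 : 1 / 2 < m₁ := by nlinarith
  have hmin : ∀ m, min m m₁ < 1 := fun m => (min_le_right _ _).trans_lt hm1
  -- Truncating `m` at `m₁ < 1` keeps the radicand positive, so `H` is continuous on the whole line.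
  set H : ℝ → ℝ := fun m => ∫ u in (-(Real.pi / 2))..(Real.pi / 2),
    (2 * min m m₁ * Real.sin u ^ 2 - (1 + ℓ)) / deltaAmp (min m m₁) u with hH
  have hcont : Continuous H := by
    refine intervalIntegral.continuous_parametric_intervalIntegral_of_continuous' ?_ _ _
    refine Continuous.div (by fun_prop) ?_ fun x => (deltaAmp_pos (hmin x.1) x.2).ne'
    unfold deltaAmp
    fun_prop
  have hHeq : ∀ m ≤ m₁, H m = ∫ u in (-(Real.pi / 2))..(Real.pi / 2),
      (2 * m * Real.sin u ^ 2 - (1 + ℓ)) / deltaAmp m u := fun m hm => by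
    simp only [hH, min_eq_left hm]
  have hlow : H (1 / 2) < 0 := by
    rw [hHeq _ hm2.le, ← neg_pos, ← intervalIntegral.integral_neg]
    refine intervalIntegral.intervalIntegral_pos_of_pos_on ?_ (fun u _ => ?_) (by linarith)
    · exact ((continuous_div_deltaAmp (by norm_num) (by fun_prop)).neg).intervalIntegrable _ _
    · rw [← neg_div]
      refine div_pos ?_ (deltaAmp_pos (by norm_num) u)
      nlinarith [Real.sin_sq_add_cos_sq u, sq_nonneg (Real.cos u), hℓ.1]
  have hhigh : 0 < H m₁ := by
    rw [hHeq _ le_rfl]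
    have hc1 := continuous_div_deltaAmp hm1 (continuous_const (y := (1 : ℝ)))
    -- Writing `Δ` for `deltaAmp m₁ u`, the right side is `(1 - ℓ)/Δ - 2Δ`, and `Δ ≤ 1`.
    have hle : ∀ u ∈ Set.Icc (-(Real.pi / 2)) (Real.pi / 2),
        (1 - ℓ) * (1 / deltaAmp m₁ u) - 2 ≤
          (2 * m₁ * Real.sin u ^ 2 - (1 + ℓ)) / deltaAmp m₁ u := by
      intro u _
      have h0 := deltaAmp_pos hm1 u
      have h1 := deltaAmp_sq hm1 u
      have h2 := deltaAmp_le_one (by linarith : 0 ≤ m₁) u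
      rw [le_div_iff₀ h0, sub_mul, mul_assoc, one_div_mul_cancel h0.ne']
      nlinarith
    have hm := intervalIntegral.integral_mono_on (μ := MeasureTheory.volume) (by linarith)
      (((hc1.const_mul (1 - ℓ)).sub continuous_const).intervalIntegrable (-(Real.pi / 2))
        (Real.pi / 2)) ((continuous_div_deltaAmp hm1 (by fun_prop)).intervalIntegrable _ _) hle
    refine lt_of_lt_of_le ?_ hm
    simp only [Pi.sub_apply]
    rw [intervalIntegral.integral_sub ((hc1.const_mul (1 - ℓ)).intervalIntegrable _ _)
      (continuous_const.intervalIntegrable _ _), intervalIntegral.integral_const_mul]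
    have hl := neg_log_le_integral_deltaAmp hq0 (by linarith)
    rw [hq, Real.log_exp, neg_neg, ← hq, ← hm₁] at hl
    have h3 : (1 - ℓ) * N = 2 * Real.pi + (1 - ℓ) := by
      rw [hN]; field_simp
    have h4 := mul_le_mul_of_nonneg_left hl hℓ1.le
    simp only [intervalIntegral.integral_const, smul_eq_mul]
    linarith
  obtain ⟨m, hm, hm0⟩ := intermediate_value_Ioo hm2.le hcont.continuousOn ⟨hlow, hhigh⟩
  refine ⟨m, ⟨hm.1, hm.2.trans hm1⟩, ?_⟩
  have hmlt := hm.2.trans hm1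
  rw [hHeq m hm.2.le] at hm0
  rw [← sub_eq_zero, ← intervalIntegral.integral_const_mul, ← intervalIntegral.integral_sub
    ((continuous_div_deltaAmp hmlt (by fun_prop)).intervalIntegrable _ _)
    (((continuous_div_deltaAmp hmlt (by fun_prop)).const_mul ℓ).intervalIntegrable _ _), ← hm0]
  refine intervalIntegral.integral_congr fun u _ => ?_
  ring

/-- The rescaled Jacobi amplitude. -/
theorem exists_amplitude {m : ℝ} (hm : m ∈ Set.Ioo (0 : ℝ) 1) :
    ∃ v : ℝ → ℝ, v 0 = -(Real.pi / 2) ∧ v 1 = Real.pi / 2 ∧ ∀ s, HasDerivAt v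
      ((∫ u in (-(Real.pi / 2))..(Real.pi / 2), 1 / deltaAmp m u) * deltaAmp m (v s)) s := by
  have hc := continuous_div_deltaAmp hm.2 (continuous_const (y := (1 : ℝ)))
  set f : ℝ → ℝ := fun u => ∫ w in (-(Real.pi / 2))..u, 1 / deltaAmp m w with hf
  have hd : ∀ u, HasDerivAt f (1 / deltaAmp m u) u := fun u =>
    (hc.integral_hasStrictDerivAt _ u).hasDerivAt
  have hpos : ∀ u, 0 < 1 / deltaAmp m u := fun u => one_div_pos.2 (deltaAmp_pos hm.2 u)
  have hmono : StrictMono f := strictMono_of_deriv_pos fun u => by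
    rw [(hd u).deriv]; exact hpos u
  have hcf : Continuous f := continuous_iff_continuousAt.2 fun u => (hd u).continuousAt
  -- The integrand is at least `1`, so `f` grows at least linearly in both directions and is onto;
  -- the amplitude is its rescaled inverse.
  have hg : Monotone fun u => f u - u := by
    have hd' : ∀ u, HasDerivAt (fun u => f u - u) (1 / deltaAmp m u - 1) u := fun u =>
      (hd u).sub (hasDerivAt_id u)
    refine monotone_of_deriv_nonneg (fun u => (hd' u).differentiableAt) fun u => ?_
    rw [(hd' u).deriv, sub_nonneg]
    exact one_le_one_div (deltaAmp_pos hm.2 u) (deltaAmp_le_one hm.1.le u)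
  have hsurj : Function.Surjective f := by
    refine hcf.surjective ?_ ?_
    · refine Filter.tendsto_atTop_mono' _ ?_
        (Filter.tendsto_atTop_add_const_right Filter.atTop (f 0) Filter.tendsto_id)
      filter_upwards [Filter.eventually_ge_atTop 0] with u hu
      have := hg hu
      simp only [id] at this ⊢
      linarith
    · refine Filter.tendsto_atBot_mono' _ ?_
        (Filter.tendsto_atBot_add_const_right Filter.atBot (f 0) Filter.tendsto_id)
      filter_upwards [Filter.eventually_le_atBot 0] with u hu
      have := hg hu
      simp only [id] at this ⊢
      linarith
  set e := hmono.orderIsoOfSurjective f hsurj with he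
  have hef : ∀ u, e u = f u := fun u => rfl
  have hinv : ∀ s, HasDerivAt e.symm (deltaAmp m (e.symm s)) s := by
    intro s
    have h := HasDerivAt.of_local_left_inverse e.symm.continuous.continuousAt (hd (e.symm s))
      (hpos _).ne' (Filter.Eventually.of_forall fun y => e.apply_symm_apply y)
    simpa using h
  refine ⟨fun s => e.symm (f (Real.pi / 2) * s), ?_, ?_, fun s => ?_⟩
  · simp only [mul_zero]
    rw [OrderIso.symm_apply_eq, hef]
    simp [hf]
  · simp only [mul_one]
    rw [OrderIso.symm_apply_eq, hef]
  · have h := (hinv (f (Real.pi / 2) * s)).comp s ((hasDerivAt_id s).const_mul (f (Real.pi / 2)))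
    exact h.congr_deriv (by simp only [hf]; ring)

/-- Bootstrapping: the radicand stays positive, so the right side of the equation is as smooth as
`v`, and `v` gains one derivative. -/
theorem contDiff_of_hasDerivAt_deltaAmp {m C : ℝ} (hm : m < 1) {v : ℝ → ℝ}
    (hv : ∀ s, HasDerivAt v (C * deltaAmp m (v s)) s) : ContDiff ℝ ∞ v := by
  rw [contDiff_infty]
  intro n
  induction n with
  | zero => exact contDiff_zero.2 (continuous_iff_continuousAt.2 fun s => (hv s).continuousAt)
  | succ n ih =>
    push_cast
    rw [contDiff_succ_iff_deriv]
    refine ⟨fun s => (hv s).differentiableAt, by simp, ?_⟩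
    rw [show deriv v = fun s => C * deltaAmp m (v s) from funext fun s => (hv s).deriv]
    refine contDiff_const.mul (ContDiff.sqrt ?_ fun s => (one_sub_mul_sin_sq_pos hm _).ne')
    exact contDiff_const.sub (contDiff_const.mul ((Real.contDiff_sin.comp ih).pow 2))

/-- The direction of the loop elastica, in terms of the amplitude. -/
def loopAngle (m : ℝ) (v : ℝ → ℝ) (s : ℝ) : ℝ := Real.pi + 2 * Real.arcsin (√m * Real.sin (v s))

theorem abs_sqrt_mul_sin_lt_one {m : ℝ} (hm : m ∈ Set.Ioo (0 : ℝ) 1) (u : ℝ) :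
    |√m * Real.sin u| < 1 := by
  rw [← sq_lt_one_iff_abs_lt_one, mul_pow, Real.sq_sqrt hm.1.le]
  linarith [one_sub_mul_sin_sq_pos hm.2 u]

theorem cos_loopAngle {m : ℝ} (hm : m ∈ Set.Ioo (0 : ℝ) 1) (v : ℝ → ℝ) (s : ℝ) :
    Real.cos (loopAngle m v s) = 2 * m * Real.sin (v s) ^ 2 - 1 := by
  have h := abs_lt.1 (abs_sqrt_mul_sin_lt_one hm (v s))
  rw [loopAngle, add_comm, Real.cos_add_pi, Real.cos_two_mul', Real.cos_sq', Real.sin_arcsin h.1.le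
    h.2.le, mul_pow, Real.sq_sqrt hm.1.le]
  ring

theorem sin_loopAngle {m : ℝ} (hm : m ∈ Set.Ioo (0 : ℝ) 1) (v : ℝ → ℝ) (s : ℝ) :
    Real.sin (loopAngle m v s) = -(2 * √m * Real.sin (v s) * deltaAmp m (v s)) := by
  have h := abs_lt.1 (abs_sqrt_mul_sin_lt_one hm (v s))
  rw [loopAngle, add_comm, Real.sin_add_pi, Real.sin_two_mul, Real.sin_arcsin h.1.le h.2.le,
    Real.cos_arcsin, mul_pow, Real.sq_sqrt hm.1.le, deltaAmp]
  ring

theorem contDiff_loopAngle {m : ℝ} (hm : m ∈ Set.Ioo (0 : ℝ) 1) {v : ℝ → ℝ}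
    (hv : ContDiff ℝ ∞ v) : ContDiff ℝ ∞ (loopAngle m v) := by
  refine contDiff_const.add (contDiff_const.mul (contDiff_iff_contDiffAt.2 fun s => ?_))
  have h := abs_lt.1 (abs_sqrt_mul_sin_lt_one hm (v s))
  have ha : ContDiffAt ℝ ∞ Real.arcsin (√m * Real.sin (v s)) :=
    Real.contDiffAt_arcsin h.1.ne' h.2.ne
  exact ContDiffAt.comp (g := Real.arcsin) (f := fun s => √m * Real.sin (v s)) s ha
    (contDiff_const.mul (Real.contDiff_sin.comp hv)).contDiffAt

/-- The factor `deltaAmp m (v s)` of `v'` cancels the denominator in the derivative of `arcsin`. -/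
theorem hasDerivAt_loopAngle {m C : ℝ} (hm : m ∈ Set.Ioo (0 : ℝ) 1) {v : ℝ → ℝ}
    (hv : ∀ s, HasDerivAt v (C * deltaAmp m (v s)) s) (s : ℝ) :
    HasDerivAt (loopAngle m v) (2 * √m * C * Real.cos (v s)) s := by
  have h := abs_lt.1 (abs_sqrt_mul_sin_lt_one hm (v s))
  have hd := deltaAmp_pos hm.2 (v s)
  have h1 := HasDerivAt.comp (h₂ := Real.arcsin) (h := fun s => √m * Real.sin (v s)) s
    (Real.hasDerivAt_arcsin h.1.ne' h.2.ne) (((hv s).sin).const_mul √m)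
  have h2 := (h1.const_mul 2).const_add Real.pi
  have he : √(1 - (√m * Real.sin (v s)) ^ 2) = deltaAmp m (v s) := by
    rw [mul_pow, Real.sq_sqrt hm.1.le, deltaAmp]
  rw [he] at h2
  exact h2.congr_deriv (by field_simp)

theorem exists_isUpperLoop {ℓ : ℝ} (hℓ : ℓ ∈ Set.Ioo (0 : ℝ) 1) : ∃ γ, IsUpperLoop ℓ γ := by
  obtain ⟨m, hm, hint⟩ := exists_modulus hℓ
  have hm0 : m ∈ Set.Ioo (0 : ℝ) 1 := ⟨by linarith [hm.1], hm.2⟩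
  obtain ⟨v, hv0, hv1, hv⟩ := exists_amplitude hm0
  have hpi := Real.pi_pos
  have hc1 := continuous_div_deltaAmp hm.2 (continuous_const (y := (1 : ℝ)))
  set C : ℝ := ∫ u in (-(Real.pi / 2))..(Real.pi / 2), 1 / deltaAmp m u with hCdef
  have hC : 0 < C := intervalIntegral.intervalIntegral_pos_of_pos_on (hc1.intervalIntegrable _ _)
    (fun u _ => one_div_pos.2 (deltaAmp_pos hm.2 u)) (by linarith)
  have hvs := contDiff_of_hasDerivAt_deltaAmp hm.2 hv
  set θ := loopAngle m v with hθdef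
  have hθs : ContDiff ℝ ∞ θ := contDiff_loopAngle hm0 hvs
  have hθ : ∀ s, HasDerivAt θ (2 * √m * C * Real.cos (v s)) s := hasDerivAt_loopAngle hm0 hv
  have hk : ∀ s, HasDerivAt (fun s => 2 * √m * C * Real.cos (v s)) (C ^ 2 * Real.sin (θ s)) s := by
    intro s
    refine (((hv s).cos).const_mul (2 * √m * C)).congr_deriv ?_
    rw [hθdef, sin_loopAngle hm0]
    ring
  have hk₁ : ∀ s, HasDerivAt (fun s => C ^ 2 * Real.sin (θ s))
      (C ^ 2 * (Real.cos (θ s) * (2 * √m * C * Real.cos (v s)))) s := fun s =>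
    ((hθ s).sin).const_mul _
  have hvmono : StrictMono v := strictMono_of_deriv_pos fun s => by
    rw [(hv s).deriv]
    exact mul_pos hC (deltaAmp_pos hm.2 _)
  have hkpos : ∀ s ∈ Set.Ioo (0 : ℝ) 1, 0 < 2 * √m * C * Real.cos (v s) := by
    intro s hs
    have h1 := hvmono hs.1
    have h2 := hvmono hs.2
    rw [hv0] at h1
    rw [hv1] at h2
    have := Real.cos_pos_of_mem_Ioo ⟨h1, h2⟩
    have := Real.sqrt_pos.2 hm0.1
    positivity
  have hθc : ContinuousOn θ I01 := hθs.continuous.continuousOn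
  have hdir := hasDirection_curveOfAngle hθc
  have hθw : ∀ x ∈ I01, HasDerivWithinAt θ (2 * √m * C * Real.cos (v x)) I01 x := fun x _ =>
    (hθ x).hasDerivWithinAt
  have hsm1 : √m < 1 := by rw [Real.sqrt_lt' one_pos]; simpa using hm.2
  have harc1 : Real.arcsin √m < Real.pi / 2 := Real.arcsin_lt_pi_div_two.2 hsm1
  -- Here `m > 1/2` is needed: it places the end directions beyond the vertical.
  have harc2 : Real.pi / 4 < Real.arcsin √m := by
    rw [Real.lt_arcsin_iff_sin_lt ⟨by linarith, by linarith⟩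
      ⟨by linarith [Real.sqrt_nonneg m], hsm1.le⟩, Real.sin_pi_div_four]
    refine Real.lt_sqrt_of_sq_lt ?_
    rw [div_pow, Real.sq_sqrt (by norm_num)]
    linarith [hm.1]
  have hθ0 : θ 0 = Real.pi - 2 * Real.arcsin √m := by
    rw [hθdef, loopAngle, hv0, Real.sin_neg, Real.sin_pi_div_two, mul_neg, mul_one,
      Real.arcsin_neg]
    ring
  have hθ1 : θ 1 = Real.pi + 2 * Real.arcsin √m := by
    rw [hθdef, loopAngle, hv1, Real.sin_pi_div_two, mul_one]
  have hsin : ∫ s in (0 : ℝ)..1, Real.sin (θ s) = 0 := by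
    have h := integral_eq_sub_of_hasDerivWithinAt (fun x _ => (hk x).hasDerivWithinAt)
      (by fun_prop) 1 (by simp)
    rw [intervalIntegral.integral_const_mul, hv0, hv1] at h
    simpa [hC.ne'] using h
  have hcos : ∫ s in (0 : ℝ)..1, Real.cos (θ s) = ℓ := by
    have hcc : Continuous fun u => (2 * m * Real.sin u ^ 2 - 1) / deltaAmp m u :=
      continuous_div_deltaAmp hm.2 (by fun_prop)
    -- The substitution `u = v s` turns the chord into the elliptic integral that determined `m`.
    have hG : ∀ s, HasDerivAt (fun s => ∫ u in (-(Real.pi / 2))..(v s),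
        (2 * m * Real.sin u ^ 2 - 1) / deltaAmp m u) (C * Real.cos (θ s)) s := by
      intro s
      have h := HasDerivAt.comp s (hcc.integral_hasStrictDerivAt (-(Real.pi / 2)) (v s)).hasDerivAt
        (hv s)
      refine h.congr_deriv ?_
      have := deltaAmp_pos hm.2 (v s)
      rw [hθdef, cos_loopAngle hm0]
      field_simp
    have h := integral_eq_sub_of_hasDerivWithinAt (fun x _ => (hG x).hasDerivWithinAt)
      (by fun_prop) 1 (by simp)
    rw [intervalIntegral.integral_const_mul, hv0, hv1, hint, intervalIntegral.integral_same,
      sub_zero, mul_comm ℓ] at h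
    exact mul_left_cancel₀ hC.ne' h
  refine ⟨curveOfAngle θ, isSmoothAdmissible_curveOfAngle hθs.contDiffOn hcos hsin,
    fun x hx => hdir.norm_velocity hx, ?_, fun x hx => ?_, θ, hdir.isTangentAngle hθc, ?_, ?_,
    fun x hx => ?_⟩
  · rw [hdir.isCritical_iff hθw (fun x _ => (hk x).hasDerivWithinAt)
      (fun x _ => (hk₁ x).hasDerivWithinAt)]
    -- The multiplier is the value of the conserved quantity `k² + 2 C² cos θ`.
    refine ⟨⟨C ^ 2 * (4 * m - 2), fun x _ => ?_⟩, by simp [hv0], by simp [hv1]⟩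
    have h1 := Real.sin_sq_add_cos_sq (v x)
    have h2 : √m ^ 2 = m := Real.sq_sqrt hm0.1.le
    have h3 : Real.cos (θ x) = 2 * m * Real.sin (v x) ^ 2 - 1 := cos_loopAngle hm0 v x
    rw [h3]
    linear_combination (-8 * C ^ 3 * √m * m * Real.cos (v x)) * h1 -
      (8 * √m * C ^ 3 * Real.cos (v x) ^ 3) * h2
  · change 0 < curveOfAngle θ x 1
    rw [curveOfAngle_apply_one hθc ⟨hx.1.le, hx.2.le⟩]
    exact integral_sin_pos hθc (strictMonoOn_of_hasDerivWithinAt_pos hθw hkpos)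
      (by linarith) (by linarith) hsin hx
  · rw [hθ0]; constructor <;> linarith
  · rw [hθ1]; constructor <;> linarith
  · have hxI : x ∈ I01 := ⟨hx.1.le, hx.2.le⟩
    rw [(hθw x hxI).derivWithin (uniqueDiffWithinAt_I01 hxI)]
    exact hkpos x hx

/-! ### From the elastica equation to the pendulum -/

/-- The direction `θ` and the curvature `k` of a loop elastica, as a solution of the pendulum
equation `θ'' = c sin θ`. -/
structure IsLoopPendulum (ℓ c : ℝ) (θ k : ℝ → ℝ) : Prop where
  continuous_angle : Continuous θ
  continuous_curv : Continuous k
  smooth_angle : ContDiffOn ℝ ∞ θ I01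
  smooth_curv : ContDiffOn ℝ ∞ k I01
  angle_deriv : ∀ x ∈ I01, HasDerivWithinAt θ (k x) I01 x
  curv_deriv : ∀ x ∈ I01, HasDerivWithinAt k (c * Real.sin (θ x)) I01 x
  c_pos : 0 < c
  curv_zero : k 0 = 0
  curv_one : k 1 = 0
  curv_pos : ∀ x ∈ Set.Ioo (0 : ℝ) 1, 0 < k x
  angle_zero : θ 0 ∈ Set.Ioo 0 (Real.pi / 2)
  angle_one : θ 1 ∈ Set.Ioo (3 * Real.pi / 2) (2 * Real.pi)
  integral_cos : ∫ x in (0 : ℝ)..1, Real.cos (θ x) = ℓ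
  integral_sin : ∫ x in (0 : ℝ)..1, Real.sin (θ x) = 0

theorem eq_of_hasDerivWithinAt_zero {F : ℝ → ℝ}
    (h : ∀ x ∈ I01, HasDerivWithinAt F 0 I01 x) {x : ℝ} (hx : x ∈ I01) : F x = F 0 := by
  have := integral_eq_sub_of_hasDerivWithinAt h continuousOn_const x hx
  simp at this
  linarith

/-- A solution of the elastica equation `-2k'' - k³ + λk = 0` that joins two distinct points of the
horizontal axis with vanishing curvature at its ends solves the pendulum equation. -/
theorem exists_pendulum {ℓ lam : ℝ} {θ k k₁ k₂ : ℝ → ℝ} (hℓ : ℓ ≠ 0)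
    (hθ : ∀ x ∈ I01, HasDerivWithinAt θ (k x) I01 x)
    (hk : ∀ x ∈ I01, HasDerivWithinAt k (k₁ x) I01 x)
    (hk₁ : ∀ x ∈ I01, HasDerivWithinAt k₁ (k₂ x) I01 x)
    (hode : ∀ x ∈ I01, -2 * k₂ x - k x ^ 3 + lam * k x = 0) (hk0 : k 0 = 0) (hk1 : k 1 = 0)
    (hcos : ∫ x in (0 : ℝ)..1, Real.cos (θ x) = ℓ) (hsin : ∫ x in (0 : ℝ)..1, Real.sin (θ x) = 0) :
    ∃ c : ℝ, ∀ x ∈ I01, k₁ x = c * Real.sin (θ x) ∧ k x ^ 2 - lam = -2 * c * Real.cos (θ x) := by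
  have hθc : ContinuousOn θ I01 := continuousOn_of_hasDerivWithinAt hθ
  have hcc : ContinuousOn (fun x => Real.cos (θ x)) I01 := Real.continuous_cos.comp_continuousOn hθc
  have hsc : ContinuousOn (fun x => Real.sin (θ x)) I01 := Real.continuous_sin.comp_continuousOn hθc
  -- `F` and `G` are the horizontal and vertical components of the force `(k² - λ) T + 2 k' N`, with
  -- `T`, `N` the unit tangent and normal. It is constant along an elastica.
  set F : ℝ → ℝ := fun x => (k x ^ 2 - lam) * Real.cos (θ x) - 2 * k₁ x * Real.sin (θ x)
  set G : ℝ → ℝ := fun x => (k x ^ 2 - lam) * Real.sin (θ x) + 2 * k₁ x * Real.cos (θ x)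
  have hF : ∀ x ∈ I01, F x = F 0 := fun x hx => by
    refine eq_of_hasDerivWithinAt_zero (fun y hy => ?_) hx
    refine (((((hk y hy).pow 2).sub_const lam).mul (hθ y hy).cos).sub
      (((hk₁ y hy).const_mul 2).mul (hθ y hy).sin)).congr_deriv ?_
    simp
    linear_combination Real.sin (θ y) * hode y hy
  have hG : ∀ x ∈ I01, G x = G 0 := fun x hx => by
    refine eq_of_hasDerivWithinAt_zero (fun y hy => ?_) hx
    refine (((((hk y hy).pow 2).sub_const lam).mul (hθ y hy).sin).add
      (((hk₁ y hy).const_mul 2).mul (hθ y hy).cos)).congr_deriv ?_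
    simp
    linear_combination -Real.cos (θ y) * hode y hy
  have hk₁eq : ∀ x ∈ I01, 2 * k₁ x = G 0 * Real.cos (θ x) - F 0 * Real.sin (θ x) := by
    intro x hx
    rw [← hF x hx, ← hG x hx]
    linear_combination (-2 * k₁ x) * Real.sin_sq_add_cos_sq (θ x)
  have hkeq : ∀ x ∈ I01, k x ^ 2 - lam = F 0 * Real.cos (θ x) + G 0 * Real.sin (θ x) := by
    intro x hx
    rw [← hF x hx, ← hG x hx]
    linear_combination (-(k x ^ 2 - lam)) * Real.sin_sq_add_cos_sq (θ x)
  -- Integrating `2 k' = G cos θ - F sin θ` gives `0 = G ℓ`, as `k` vanishes at both ends and the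
  -- chord is horizontal.
  have hG0 : G 0 = 0 := by
    have h := integral_eq_sub_of_hasDerivWithinAt hk (continuousOn_of_hasDerivWithinAt hk₁) 1
      (by simp)
    have h2 : ∫ x in (0 : ℝ)..1, k₁ x =
        ∫ x in (0 : ℝ)..1, (G 0 / 2 * Real.cos (θ x) - F 0 / 2 * Real.sin (θ x)) := by
      refine intervalIntegral.integral_congr fun x hx => ?_
      rw [Set.uIcc_of_le zero_le_one] at hx
      linear_combination (1 / 2) * hk₁eq x hx
    rw [h, hk0, hk1, intervalIntegral.integral_sub
      ((hcc.intervalIntegrable_of_Icc zero_le_one).const_mul _)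
      ((hsc.intervalIntegrable_of_Icc zero_le_one).const_mul _),
      intervalIntegral.integral_const_mul, intervalIntegral.integral_const_mul, hcos, hsin] at h2
    have h3 : G 0 * ℓ = 0 := by linarith
    exact (mul_eq_zero.1 h3).resolve_right hℓ
  refine ⟨-(F 0 / 2), fun x hx => ⟨?_, ?_⟩⟩
  · have := hk₁eq x hx
    rw [hG0] at this
    linarith
  · rw [hkeq x hx, hG0]
    ring

theorem IsUpperLoop.exists_isLoopPendulum {ℓ : ℝ} (hℓ : 0 < ℓ) {γ : ℝ → Plane}
    (h : IsUpperLoop ℓ γ) :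
    ∃ c θ k, IsLoopPendulum ℓ c θ k ∧ bendingEnergy γ = ∫ x in (0 : ℝ)..1, k x ^ 2 := by
  obtain ⟨hadm, hspeed, hcrit, -, θ, hang, hθ0, hθ1, hpos⟩ := h
  have hpi := Real.pi_pos
  have h0 : (0 : ℝ) ∈ I01 := by simp
  have h1 : (1 : ℝ) ∈ I01 := by simp
  have hvel : ∀ x ∈ I01, velocity γ x = unitVec (θ x) := fun x hx => by
    have := hang.tangent_eq x hx
    rwa [tangent, dArc, hspeed x hx, inv_one, one_smul] at this
  have hdir : HasDirection γ θ := fun x hx => by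
    rw [← hvel x hx]
    exact hasDerivWithinAt_derivWithin hadm.smooth hx
  have hvs : ∀ i, ContDiffOn ℝ ∞ (fun x => velocity γ x i) I01 :=
    contDiffOn_euclidean.1 (contDiffOn_derivWithin hadm.smooth)
  have hs : ContDiffOn ℝ ∞ θ I01 := by
    refine contDiffOn_angle hang.continuousOn ((hvs 0).congr fun x hx => ?_)
      ((hvs 1).congr fun x hx => ?_) <;> simp [hvel x hx, unitVec]
  have hk := contDiffOn_derivWithin hs
  have hk₁ := contDiffOn_derivWithin hk
  have dθ : ∀ x ∈ I01, HasDerivWithinAt θ (derivWithin θ I01 x) I01 x := fun x hx =>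
    hasDerivWithinAt_derivWithin hs hx
  obtain ⟨⟨lam, hode⟩, hk0, hk1⟩ := (hdir.isCritical_iff dθ
    (fun x hx => hasDerivWithinAt_derivWithin hk hx)
    (fun x hx => hasDerivWithinAt_derivWithin hk₁ hx)).1 hcrit
  have hcos : ∫ x in (0 : ℝ)..1, Real.cos (θ x) = ℓ := by
    rw [hdir.apply_zero hang.continuousOn h1, hadm.start_eq, hadm.end_eq]
    simp
  have hsin : ∫ x in (0 : ℝ)..1, Real.sin (θ x) = 0 := by
    rw [hdir.apply_one hang.continuousOn h1, hadm.start_eq, hadm.end_eq]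
    simp
  obtain ⟨c, hc⟩ := exists_pendulum hℓ.ne' dθ (fun x hx => hasDerivWithinAt_derivWithin hk hx)
    (fun x hx => hasDerivWithinAt_derivWithin hk₁ hx) hode hk0 hk1 hcos hsin
  -- Comparing the conserved quantity at `0` and where `θ = π` gives `k² = 2 c (1 + cos θ(0))` at
  -- the latter point.
  have hcpos : 0 < c := by
    obtain ⟨x, hx, hxpi⟩ := intermediate_value_Ioo zero_le_one hang.continuousOn
      (show Real.pi ∈ Set.Ioo (θ 0) (θ 1) from
        ⟨by linarith [hθ0.2], by linarith [hθ1.1]⟩)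
    have e0 := (hc 0 h0).2
    have e1 := (hc x ⟨hx.1.le, hx.2.le⟩).2
    rw [hk0] at e0
    rw [hxpi, Real.cos_pi] at e1
    have hkx := pow_pos (hpos x hx) 2
    have hcos0 : 0 < Real.cos (θ 0) :=
      Real.cos_pos_of_mem_Ioo ⟨by linarith [hθ0.1], hθ0.2⟩
    have : 0 < (2 * (1 + Real.cos (θ 0))) * c := by linarith
    exact pos_of_mul_pos_right this (by linarith)
  -- The data are arbitrary outside the interval; precomposing with the projection makes them
  -- continuous on the line and changes nothing on the interval.
  set p : ℝ → ℝ := fun x => Set.projIcc (0 : ℝ) 1 zero_le_one x with hp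
  have hpc : Continuous p := continuous_subtype_val.comp continuous_projIcc
  have hpI : ∀ x, p x ∈ I01 := fun x => (Set.projIcc (0 : ℝ) 1 zero_le_one x).2
  have hpe : ∀ x ∈ I01, p x = x := fun x hx => by
    simp only [hp, Set.projIcc_of_mem zero_le_one hx]
  have eθ : Set.EqOn (fun x => θ (p x)) θ I01 := fun x hx => by simp only [hpe x hx]
  have ek : Set.EqOn (fun x => derivWithin θ I01 (p x)) (derivWithin θ I01) I01 := fun x hx => by
    simp only [hpe x hx]
  have p0 := hpe 0 h0
  have p1 := hpe 1 h1
  have ecos : ∀ f : ℝ → ℝ, ∫ x in (0 : ℝ)..1, f (p x) = ∫ x in (0 : ℝ)..1, f x := fun f => by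
    refine intervalIntegral.integral_congr fun x hx => ?_
    rw [Set.uIcc_of_le zero_le_one] at hx
    simp only [hpe x hx]
  refine ⟨c, fun x => θ (p x), fun x => derivWithin θ I01 (p x),
    ⟨hang.continuousOn.comp_continuous hpc hpI, hk.continuousOn.comp_continuous hpc hpI,
      hs.congr eθ, hk.congr ek, fun x hx => ?_, fun x hx => ?_, hcpos, ?_, ?_, fun x hx => ?_, ?_,
      ?_, ?_, ?_⟩, ?_⟩
  · simp only [hpe x hx]
    exact (dθ x hx).congr eθ (eθ hx)
  · simp only [hpe x hx]
    rw [← (hc x hx).1]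
    exact (hasDerivWithinAt_derivWithin hk hx).congr ek (ek hx)
  · simpa only [p0] using hk0
  · simpa only [p1] using hk1
  · simpa only [hpe x ⟨hx.1.le, hx.2.le⟩] using hpos x hx
  · simpa only [p0] using hθ0
  · simpa only [p1] using hθ1
  · exact (ecos fun x => Real.cos (θ x)).trans hcos
  · exact (ecos fun x => Real.sin (θ x)).trans hsin
  · rw [hdir.bendingEnergy_eq dθ]
    exact (ecos fun x => derivWithin θ I01 x ^ 2).symm

/-! ### Expansion of the chord under a change of direction -/

theorem abs_cos_sub_one_add_le (h : ℝ) : |Real.cos h - 1 + h ^ 2 / 2| ≤ |h| ^ 3 := by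
  rcases le_total |h| 1 with h1 | h1
  · have hb := Real.cos_bound h1
    have e : Real.cos h - 1 + h ^ 2 / 2 = Real.cos h - (1 - h ^ 2 / 2) := by ring
    have h4 : |h| ^ 4 ≤ |h| ^ 3 := pow_le_pow_of_le_one (abs_nonneg h) h1 (by norm_num)
    rw [e]
    nlinarith [abs_nonneg h, pow_nonneg (abs_nonneg h) 4]
  · have hl := Real.one_sub_sq_div_two_le_cos (x := h)
    have hu := Real.cos_le_one h
    have h3 : |h| ^ 2 ≤ |h| ^ 3 := pow_le_pow_right₀ h1 (by norm_num)
    rw [sq_abs] at h3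
    rw [abs_of_nonneg (by linarith)]
    nlinarith [sq_nonneg h]

theorem abs_sin_sub_le (h : ℝ) : |Real.sin h - h| ≤ 2 * |h| ^ 3 := by
  rcases le_total |h| 1 with h1 | h1
  · have hb := abs_le.1 (Real.sin_bound h1)
    have h4 : |h| ^ 5 ≤ |h| ^ 3 := pow_le_pow_of_le_one (abs_nonneg h) h1 (by norm_num)
    have h5 := abs_le.1 (abs_pow h 3).le
    have h6 := pow_nonneg (abs_nonneg h) 3
    rw [abs_le]
    constructor <;> linarith [hb.1, hb.2, h5.1, h5.2]
  · have h3 : |h| ^ 1 ≤ |h| ^ 3 := pow_le_pow_right₀ h1 (by norm_num)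
    have := abs_sub (Real.sin h) h
    have := Real.abs_sin_le_abs (x := h)
    linarith

theorem abs_cos_add_sub_le (a h : ℝ) :
    |Real.cos (a + h) - (Real.cos a - h * Real.sin a - h ^ 2 / 2 * Real.cos a)| ≤ 3 * |h| ^ 3 := by
  have e : Real.cos (a + h) - (Real.cos a - h * Real.sin a - h ^ 2 / 2 * Real.cos a) =
      Real.cos a * (Real.cos h - 1 + h ^ 2 / 2) - Real.sin a * (Real.sin h - h) := by
    rw [Real.cos_add]; ring
  rw [e]
  refine (abs_sub _ _).trans ?_
  rw [abs_mul, abs_mul]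
  have h1 := mul_le_mul (Real.abs_cos_le_one a) (abs_cos_sub_one_add_le h) (abs_nonneg _)
    zero_le_one
  have h2 := mul_le_mul (Real.abs_sin_le_one a) (abs_sin_sub_le h) (abs_nonneg _)
    zero_le_one
  linarith

theorem abs_sin_add_sub_le (a h : ℝ) :
    |Real.sin (a + h) - (Real.sin a + h * Real.cos a)| ≤ 3 * |h| ^ 2 := by
  have e : Real.sin (a + h) - (Real.sin a + h * Real.cos a) =
      Real.sin a * (Real.cos h - 1) + Real.cos a * (Real.sin h - h) := by
    rw [Real.sin_add]; ring
  have hc : |Real.cos h - 1| ≤ |h| ^ 2 := by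
    rw [sq_abs, abs_le]
    constructor <;> nlinarith [Real.one_sub_sq_div_two_le_cos (x := h), Real.cos_le_one h,
      sq_nonneg h]
  have hs : |Real.sin h - h| ≤ 2 * |h| ^ 2 := by
    rcases le_total |h| 1 with h1 | h1
    · have := pow_le_pow_of_le_one (abs_nonneg h) h1 (by norm_num : 2 ≤ 3)
      linarith [abs_sin_sub_le h]
    · have h3 : |h| ^ 1 ≤ |h| ^ 2 := pow_le_pow_right₀ h1 (by norm_num)
      have := abs_sub (Real.sin h) h
      have := Real.abs_sin_le_abs (x := h)
      linarith
  rw [e]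
  refine (abs_add_le _ _).trans ?_
  rw [abs_mul, abs_mul]
  have h1 := mul_le_mul (Real.abs_sin_le_one a) hc (abs_nonneg _) zero_le_one
  have h2 := mul_le_mul (Real.abs_cos_le_one a) hs (abs_nonneg _) zero_le_one
  linarith

theorem abs_integral_le_of_forall_abs_le {f : ℝ → ℝ} {C : ℝ} (h : ∀ x ∈ I01, |f x| ≤ C) :
    |∫ x in (0 : ℝ)..1, f x| ≤ C := by
  have := intervalIntegral.norm_integral_le_of_norm_le_const (a := 0) (b := 1) (f := f) (C := C)
    fun x hx => by
      rw [Set.uIoc_of_le zero_le_one] at hx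
      exact h x ⟨hx.1.le, hx.2⟩
  simpa using this

/-- Expansion of the displacement of a curve of direction `θ + εa + ε²b`. -/
theorem exists_displacement_bound {θ a b : ℝ → ℝ} (hθ : Continuous θ) (ha : Continuous a)
    (hb : Continuous b) : ∃ K, 0 ≤ K ∧ ∀ ε ∈ I01,
      |(∫ x in (0 : ℝ)..1, Real.cos (θ x + (ε * a x + ε ^ 2 * b x))) -
        ((∫ x in (0 : ℝ)..1, Real.cos (θ x)) - ε * (∫ x in (0 : ℝ)..1, Real.sin (θ x) * a x) -
          ε ^ 2 * ∫ x in (0 : ℝ)..1, (Real.sin (θ x) * b x + Real.cos (θ x) * a x ^ 2 / 2))|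
        ≤ K * ε ^ 3 ∧
      |(∫ x in (0 : ℝ)..1, Real.sin (θ x + (ε * a x + ε ^ 2 * b x))) -
        ((∫ x in (0 : ℝ)..1, Real.sin (θ x)) + ε * ∫ x in (0 : ℝ)..1, Real.cos (θ x) * a x)|
        ≤ K * ε ^ 2 := by
  obtain ⟨A, hA⟩ := isCompact_Icc.exists_bound_of_continuousOn (s := I01) ha.continuousOn
  obtain ⟨B, hB⟩ := isCompact_Icc.exists_bound_of_continuousOn (s := I01) hb.continuousOn
  simp only [Real.norm_eq_abs] at hA hB
  have hA0 : 0 ≤ A := (abs_nonneg _).trans (hA 0 (by simp))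
  have hB0 : 0 ≤ B := (abs_nonneg _).trans (hB 0 (by simp))
  set U := A + B with hU
  have hU0 : 0 ≤ U := add_nonneg hA0 hB0
  have hh : ∀ ε ∈ I01, ∀ x ∈ I01, |ε * a x + ε ^ 2 * b x| ≤ ε * U := by
    intro ε hε x hx
    refine (abs_add_le _ _).trans ?_
    rw [abs_mul, abs_mul, abs_of_nonneg hε.1, abs_of_nonneg (sq_nonneg ε), hU, mul_add]
    have : ε ^ 2 ≤ ε := by nlinarith [hε.1, hε.2]
    exact add_le_add (mul_le_mul_of_nonneg_left (hA x hx) hε.1)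
      (mul_le_mul this (hB x hx) (abs_nonneg _) hε.1)
  -- The sum of the two remainder constants, `3U³ + 2U²` for the cosine and `3U² + U` for the sine.
  refine ⟨3 * U ^ 3 + 2 * U ^ 2 + 3 * U ^ 2 + U, by positivity, fun ε hε => ⟨?_, ?_⟩⟩
  · have e : (∫ x in (0 : ℝ)..1, Real.cos (θ x + (ε * a x + ε ^ 2 * b x))) -
        ((∫ x in (0 : ℝ)..1, Real.cos (θ x)) - ε * (∫ x in (0 : ℝ)..1, Real.sin (θ x) * a x) -
          ε ^ 2 * ∫ x in (0 : ℝ)..1, (Real.sin (θ x) * b x + Real.cos (θ x) * a x ^ 2 / 2)) =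
        ∫ x in (0 : ℝ)..1, (Real.cos (θ x + (ε * a x + ε ^ 2 * b x)) -
          (Real.cos (θ x) - ε * (Real.sin (θ x) * a x) -
            ε ^ 2 * (Real.sin (θ x) * b x + Real.cos (θ x) * a x ^ 2 / 2))) := by
      rw [← intervalIntegral.integral_const_mul, ← intervalIntegral.integral_const_mul,
        ← intervalIntegral.integral_sub, ← intervalIntegral.integral_sub,
        ← intervalIntegral.integral_sub] <;>
      exact Continuous.intervalIntegrable (by fun_prop) _ _
    rw [e]
    refine (abs_integral_le_of_forall_abs_le (C := 3 * (ε * U) ^ 3 + 2 * U ^ 2 * ε ^ 3)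
      fun x hx => ?_).trans ?_
    · have e2 : Real.cos (θ x + (ε * a x + ε ^ 2 * b x)) - (Real.cos (θ x) -
          ε * (Real.sin (θ x) * a x) -
            ε ^ 2 * (Real.sin (θ x) * b x + Real.cos (θ x) * a x ^ 2 / 2)) =
          (Real.cos (θ x + (ε * a x + ε ^ 2 * b x)) - (Real.cos (θ x) -
            (ε * a x + ε ^ 2 * b x) * Real.sin (θ x) -
              (ε * a x + ε ^ 2 * b x) ^ 2 / 2 * Real.cos (θ x))) -
            Real.cos (θ x) * (ε ^ 3 * (b x * (a x + ε * b x / 2))) := by ring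
      rw [e2]
      refine (abs_sub _ _).trans (add_le_add ((abs_cos_add_sub_le _ _).trans ?_) ?_)
      · have := pow_le_pow_left₀ (abs_nonneg _) (hh ε hε x hx) 3
        linarith
      · rw [abs_mul, abs_mul, abs_mul, abs_of_nonneg (pow_nonneg hε.1 3)]
        have h1 : |b x| ≤ U := (hB x hx).trans (by linarith)
        have h2 : |a x + ε * b x / 2| ≤ 2 * U := by
          refine (abs_add_le _ _).trans ?_
          rw [abs_div, abs_mul, abs_of_nonneg hε.1, abs_two]
          have := mul_le_mul hε.2 (hB x hx) (abs_nonneg _) zero_le_one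
          linarith [hA x hx]
        have h3 := mul_le_mul h1 h2 (abs_nonneg _) hU0
        have h4 := mul_le_mul_of_nonneg_left h3 (pow_nonneg hε.1 3)
        have h5 := mul_le_mul (Real.abs_cos_le_one (θ x)) h4
          (mul_nonneg (pow_nonneg hε.1 3) (by positivity)) zero_le_one
        linarith
    · have : 0 ≤ (3 * U ^ 2 + U) * ε ^ 3 := mul_nonneg (by positivity) (pow_nonneg hε.1 3)
      linarith
  · have e : (∫ x in (0 : ℝ)..1, Real.sin (θ x + (ε * a x + ε ^ 2 * b x))) -
        ((∫ x in (0 : ℝ)..1, Real.sin (θ x)) + ε * ∫ x in (0 : ℝ)..1, Real.cos (θ x) * a x) =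
        ∫ x in (0 : ℝ)..1, (Real.sin (θ x + (ε * a x + ε ^ 2 * b x)) -
          (Real.sin (θ x) + ε * (Real.cos (θ x) * a x))) := by
      rw [← intervalIntegral.integral_const_mul, ← intervalIntegral.integral_add,
        ← intervalIntegral.integral_sub] <;>
      exact Continuous.intervalIntegrable (by fun_prop) _ _
    rw [e]
    refine (abs_integral_le_of_forall_abs_le (C := 3 * (ε * U) ^ 2 + U * ε ^ 2)
      fun x hx => ?_).trans ?_
    · have e2 : Real.sin (θ x + (ε * a x + ε ^ 2 * b x)) -
          (Real.sin (θ x) + ε * (Real.cos (θ x) * a x)) =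
          (Real.sin (θ x + (ε * a x + ε ^ 2 * b x)) - (Real.sin (θ x) +
            (ε * a x + ε ^ 2 * b x) * Real.cos (θ x))) +
            Real.cos (θ x) * (ε ^ 2 * b x) := by ring
      rw [e2]
      refine (abs_add_le _ _).trans (add_le_add ((abs_sin_add_sub_le _ _).trans ?_) ?_)
      · have := pow_le_pow_left₀ (abs_nonneg _) (hh ε hε x hx) 2
        linarith
      · rw [abs_mul, abs_mul, abs_of_nonneg (sq_nonneg ε)]
        have h1 : |b x| ≤ U := (hB x hx).trans (by linarith)
        have h4 := mul_le_mul_of_nonneg_left h1 (sq_nonneg ε)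
        have h5 := mul_le_mul (Real.abs_cos_le_one (θ x)) h4
          (mul_nonneg (sq_nonneg ε) (abs_nonneg _)) zero_le_one
        linarith
    · have : 0 ≤ (3 * U ^ 3 + 2 * U ^ 2) * ε ^ 2 := mul_nonneg (by positivity) (sq_nonneg ε)
      linarith

theorem eventually_pos_of_continuous {f : ℝ → ℝ} (hf : Continuous f) (h : 0 < f 0) :
    ∀ᶠ ε in nhdsWithin (0 : ℝ) (Set.Ioi 0), 0 < f ε :=
  (hf.continuousAt.eventually (lt_mem_nhds h)).filter_mono nhdsWithin_le_nhds

theorem eventually_mem_I01 : ∀ᶠ ε in nhdsWithin (0 : ℝ) (Set.Ioi 0), ε ∈ I01 := by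
  filter_upwards [Ioo_mem_nhdsGT (zero_lt_one (α := ℝ))] with ε hε using ⟨hε.1.le, hε.2.le⟩

/-- The squared distance of the ends of a curve of direction `θ`. -/
def sqChord (θ : ℝ → ℝ) : ℝ :=
  (∫ x in (0 : ℝ)..1, Real.cos (θ x)) ^ 2 + (∫ x in (0 : ℝ)..1, Real.sin (θ x)) ^ 2

/-- The horizontal part decreases at first order in `ε`, whereas the vertical part starts from `0`
and enters only through its square, of order `ε²`. -/
theorem eventually_sqChord_lt {θ a : ℝ → ℝ} {ℓ : ℝ} (hℓ : 0 < ℓ) (hθ : Continuous θ)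
    (ha : Continuous a) (hcos : ∫ x in (0 : ℝ)..1, Real.cos (θ x) = ℓ)
    (hsin : ∫ x in (0 : ℝ)..1, Real.sin (θ x) = 0)
    (hpos : 0 < ∫ x in (0 : ℝ)..1, Real.sin (θ x) * a x) :
    ∀ᶠ ε in nhdsWithin (0 : ℝ) (Set.Ioi 0), sqChord (fun x => θ x + ε * a x) < ℓ ^ 2 := by
  obtain ⟨K, hK, hKε⟩ := exists_displacement_bound hθ ha (continuous_const (y := (0 : ℝ)))
  simp only [mul_zero, add_zero, zero_add, hcos, hsin] at hKε
  set β := ∫ x in (0 : ℝ)..1, Real.sin (θ x) * a x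
  set X₂ := ∫ x in (0 : ℝ)..1, Real.cos (θ x) * a x ^ 2 / 2
  set Y₁ := ∫ x in (0 : ℝ)..1, Real.cos (θ x) * a x
  filter_upwards [eventually_mem_I01, self_mem_nhdsWithin,
    eventually_pos_of_continuous (f := fun ε => ℓ - ε * (β + |X₂| + K)) (by fun_prop) (by simpa),
    eventually_pos_of_continuous (f := fun ε => β / 2 - ε * (|X₂| + K)) (by fun_prop)
      (by simp; linarith),
    eventually_pos_of_continuous (f := fun ε => β / 2 * ℓ - ε * (|Y₁| + K) ^ 2) (by fun_prop)
      (by simp; positivity)] with ε hε hε0 h1 h2 h3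
  obtain ⟨hX, hY⟩ := hKε ε hε
  rw [sqChord]
  set X := ∫ x in (0 : ℝ)..1, Real.cos (θ x + ε * a x)
  set Y := ∫ x in (0 : ℝ)..1, Real.sin (θ x + ε * a x)
  have hε0' : 0 < ε := hε0
  have hsq : ε ^ 2 ≤ ε := by nlinarith [hε.2]
  have hcu : ε ^ 3 ≤ ε ^ 2 := by nlinarith [hε.2, sq_nonneg ε]
  have hX₂ := mul_le_mul_of_nonneg_left (neg_le_abs X₂) (sq_nonneg ε)
  have hX₂' := mul_le_mul_of_nonneg_left (le_abs_self X₂) (sq_nonneg ε)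
  have hKcu := mul_le_mul_of_nonneg_left hcu hK
  have hXu : X ≤ ℓ - ε * (β / 2) := by
    have := (abs_le.1 hX).2
    nlinarith [mul_pos hε0' h2]
  have hXl : 0 ≤ X := by
    have h4 := (abs_le.1 hX).1
    have h5 : ε ^ 2 * |X₂| ≤ ε * |X₂| := mul_le_mul_of_nonneg_right hsq (abs_nonneg _)
    have h6 : K * ε ^ 2 ≤ K * ε := mul_le_mul_of_nonneg_left hsq hK
    nlinarith
  have hYa : |Y| ≤ ε * (|Y₁| + K) := by
    have h4 : |Y| ≤ |Y - (0 + ε * Y₁)| + |ε * Y₁| := by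
      have := abs_add_le (Y - (0 + ε * Y₁)) (ε * Y₁)
      simpa using this
    rw [abs_mul, abs_of_pos hε0'] at h4
    have h6 : K * ε ^ 2 ≤ K * ε := mul_le_mul_of_nonneg_left hsq hK
    simp only [zero_add] at h4
    linarith
  have hY2 : Y ^ 2 ≤ (ε * (|Y₁| + K)) ^ 2 := by
    rw [← sq_abs Y]
    exact pow_le_pow_left₀ (abs_nonneg _) hYa 2
  have hYlt : Y ^ 2 < ε * (β / 2) * ℓ := by nlinarith [mul_pos hε0' h3]
  have : 0 ≤ ε * (β / 2) * X := by positivity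
  nlinarith

/-- Without a first-order horizontal change, everything happens at order `ε²`: the horizontal square
changes by `-2ℓ` times the second-order integral, the vertical one gains the square of the
first-order drift. -/
theorem eventually_lt_sqChord {θ a b : ℝ → ℝ} {ℓ : ℝ} (hℓ : 0 < ℓ) (hθ : Continuous θ)
    (ha : Continuous a) (hb : Continuous b) (hcos : ∫ x in (0 : ℝ)..1, Real.cos (θ x) = ℓ)
    (hsin : ∫ x in (0 : ℝ)..1, Real.sin (θ x) = 0)
    (hzero : ∫ x in (0 : ℝ)..1, Real.sin (θ x) * a x = 0)
    (hlt : 2 * ℓ * ∫ x in (0 : ℝ)..1, (Real.sin (θ x) * b x + Real.cos (θ x) * a x ^ 2 / 2) <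
      (∫ x in (0 : ℝ)..1, Real.cos (θ x) * a x) ^ 2) :
    ∀ᶠ ε in nhdsWithin (0 : ℝ) (Set.Ioi 0),
      ℓ ^ 2 < sqChord (fun x => θ x + (ε * a x + ε ^ 2 * b x)) := by
  obtain ⟨K, hK, hKε⟩ := exists_displacement_bound hθ ha hb
  simp only [hcos, hsin, hzero, mul_zero, sub_zero, zero_add] at hKε
  set X₂ := ∫ x in (0 : ℝ)..1, (Real.sin (θ x) * b x + Real.cos (θ x) * a x ^ 2 / 2)
  set Y₁ := ∫ x in (0 : ℝ)..1, Real.cos (θ x) * a x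
  filter_upwards [eventually_mem_I01, self_mem_nhdsWithin,
    eventually_pos_of_continuous (f := fun ε => Y₁ ^ 2 - 2 * ℓ * X₂ - ε * (2 * K * (ℓ + |Y₁|)))
      (by fun_prop) (by simp; linarith)] with ε hε hε0 h1
  obtain ⟨hX, hY⟩ := hKε ε hε
  rw [sqChord]
  set X := ∫ x in (0 : ℝ)..1, Real.cos (θ x + (ε * a x + ε ^ 2 * b x))
  set Y := ∫ x in (0 : ℝ)..1, Real.sin (θ x + (ε * a x + ε ^ 2 * b x))
  have hε0' : 0 < ε := hε0
  have hX1 : ℓ - ε ^ 2 * X₂ - K * ε ^ 3 ≤ X := by linarith [(abs_le.1 hX).1]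
  -- A square lies above its tangent line, here at `ℓ`; for `Y` below, the tangent at `ε Y₁` is
  -- used.
  have hX2 : 2 * ℓ * (ℓ - ε ^ 2 * X₂ - K * ε ^ 3) - ℓ ^ 2 ≤ X ^ 2 := by
    nlinarith [sq_nonneg (X - ℓ)]
  have hY1 : (ε * Y₁) ^ 2 - 2 * ε * (|Y₁| * (K * ε ^ 2)) ≤ Y ^ 2 := by
    have h2 := mul_le_mul_of_nonneg_left hY (abs_nonneg Y₁)
    rw [← abs_mul] at h2
    have h3 := (abs_le.1 h2).1
    have h4 := mul_le_mul_of_nonneg_left h3 hε.1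
    nlinarith [sq_nonneg (Y - ε * Y₁)]
  nlinarith [mul_pos (pow_pos hε0' 2) h1]

/-! ### An unstable direction at the loop -/

/-- The smooth positive approximation `√(k² + η²)` of the curvature `k ≥ 0`. -/
def regCurv (η : ℝ) (k : ℝ → ℝ) (x : ℝ) : ℝ := √(k x ^ 2 + η ^ 2)

theorem regCurv_sq (η : ℝ) (k : ℝ → ℝ) (x : ℝ) : regCurv η k x ^ 2 = k x ^ 2 + η ^ 2 :=
  Real.sq_sqrt (by positivity)

theorem le_regCurv (η : ℝ) (k : ℝ → ℝ) (x : ℝ) : η ≤ regCurv η k x :=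
  Real.le_sqrt_of_sq_le (by linarith [sq_nonneg (k x)])

theorem abs_regCurv_sub_le {η : ℝ} (hη : 0 ≤ η) {k : ℝ → ℝ} {x : ℝ} (hk : 0 ≤ k x) :
    |regCurv η k x - k x| ≤ η := by
  have h1 : k x ≤ regCurv η k x := Real.le_sqrt_of_sq_le (by linarith [sq_nonneg η])
  have h2 : regCurv η k x ≤ k x + η :=
    Real.sqrt_le_iff.2 ⟨by positivity, by nlinarith [mul_nonneg hk hη]⟩
  rw [abs_of_nonneg (by linarith)]
  linarith

namespace IsLoopPendulum

variable {ℓ c η : ℝ} {θ k : ℝ → ℝ}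

theorem continuous_regCurv (h : IsLoopPendulum ℓ c θ k) : Continuous (regCurv η k) := by
  have := h.continuous_curv
  unfold regCurv
  fun_prop

theorem continuous_regCurv_deriv (h : IsLoopPendulum ℓ c θ k) (hη : 0 < η) :
    Continuous fun x => k x * (c * Real.sin (θ x)) / regCurv η k x :=
  (h.continuous_curv.mul (continuous_const.mul (Real.continuous_sin.comp h.continuous_angle))).div
    h.continuous_regCurv fun x => (hη.trans_le (le_regCurv η k x)).ne'

theorem hasDerivWithinAt_regCurv (h : IsLoopPendulum ℓ c θ k) (hη : 0 < η) {x : ℝ}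
    (hx : x ∈ I01) :
    HasDerivWithinAt (regCurv η k) (k x * (c * Real.sin (θ x)) / regCurv η k x) I01 x := by
  have hp : 0 < k x ^ 2 + η ^ 2 := by positivity
  refine ((((h.curv_deriv x hx).pow 2).add_const (η ^ 2)).sqrt hp.ne').congr_deriv ?_
  have : 0 < √(k x ^ 2 + η ^ 2) := Real.sqrt_pos.2 hp
  simp only [regCurv, Pi.pow_apply]
  field_simp
  ring

theorem contDiffOn_regCurv (h : IsLoopPendulum ℓ c θ k) (hη : 0 < η) :
    ContDiffOn ℝ ∞ (regCurv η k) I01 :=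
  ((h.smooth_curv.pow 2).add contDiffOn_const).sqrt fun x _ =>
    (by positivity : 0 < k x ^ 2 + η ^ 2).ne'

theorem curv_nonneg (h : IsLoopPendulum ℓ c θ k) {x : ℝ} (hx : x ∈ I01) : 0 ≤ k x := by
  rcases hx.1.eq_or_lt with rfl | h0
  · exact h.curv_zero.ge
  rcases hx.2.eq_or_lt with rfl | h1
  · exact h.curv_one.ge
  exact (h.curv_pos x ⟨h0, h1⟩).le

theorem energy_pos (h : IsLoopPendulum ℓ c θ k) : 0 < ∫ x in (0 : ℝ)..1, k x ^ 2 :=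
  intervalIntegral.intervalIntegral_pos_of_pos_on ((h.continuous_curv.pow 2).intervalIntegrable _ _)
    (fun x hx => pow_pos (h.curv_pos x hx) 2) one_pos

/-- Since `c sin θ = k'` and `regCurv` depends on `x` only through `k`, the integrand is, up to the
factor `c`, the derivative of a function of `k`, and `k` agrees at the ends. Thus moving along
`regCurv` fixes the horizontal chord to first order. -/
theorem integral_sin_mul_regCurv (h : IsLoopPendulum ℓ c θ k) :
    ∫ x in (0 : ℝ)..1, Real.sin (θ x) * regCurv η k x = 0 := by
  have hc : Continuous fun y : ℝ => √(y ^ 2 + η ^ 2) := by fun_prop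
  have hθ := h.continuous_angle
  have hφ := h.continuous_regCurv (η := η)
  have hd : ∀ x ∈ I01, HasDerivWithinAt (fun x => ∫ y in (0 : ℝ)..k x, √(y ^ 2 + η ^ 2))
      (c * (Real.sin (θ x) * regCurv η k x)) I01 x := fun x hx => by
    refine ((hc.integral_hasStrictDerivAt 0 (k x)).hasDerivAt.comp_hasDerivWithinAt x
      (h.curv_deriv x hx)).congr_deriv ?_
    simp only [regCurv]
    ring
  have := integral_eq_sub_of_hasDerivWithinAt hd (by fun_prop) 1 (by simp)
  rw [intervalIntegral.integral_const_mul, h.curv_zero, h.curv_one, sub_self] at this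
  exact (mul_eq_zero.1 this).resolve_left h.c_pos.ne'

/-- Integration by parts reduces this to the previous orthogonality. It removes the cross term from
the energy of the deformed curve. -/
theorem integral_curv_mul_deriv_regCurv (h : IsLoopPendulum ℓ c θ k) (hη : 0 < η) :
    ∫ x in (0 : ℝ)..1, k x * (k x * (c * Real.sin (θ x)) / regCurv η k x) = 0 := by
  have hθ := h.continuous_angle
  have hk := h.continuous_curv
  have hφ := h.continuous_regCurv (η := η)
  have hφ₁ := h.continuous_regCurv_deriv hη
  have hd : ∀ x ∈ I01, HasDerivWithinAt (fun x => k x * regCurv η k x)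
      (c * (Real.sin (θ x) * regCurv η k x) +
        k x * (k x * (c * Real.sin (θ x)) / regCurv η k x)) I01 x := fun x hx => by
    refine ((h.curv_deriv x hx).mul (h.hasDerivWithinAt_regCurv hη hx)).congr_deriv ?_
    ring
  have := integral_eq_sub_of_hasDerivWithinAt hd (by fun_prop) 1 (by simp)
  rw [intervalIntegral.integral_add (Continuous.intervalIntegrable (by fun_prop) _ _)
    (Continuous.intervalIntegrable (by fun_prop) _ _), intervalIntegral.integral_const_mul,
    h.integral_sin_mul_regCurv, h.curv_zero, h.curv_one] at this
  simpa using this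

/-- Integration by parts with `c sin θ = k'`. The sign shows that shrinking the direction towards
`π` shortens the chord. -/
theorem integral_sin_mul_angle (h : IsLoopPendulum ℓ c θ k) :
    c * ∫ x in (0 : ℝ)..1, Real.sin (θ x) * (θ x - Real.pi) = -∫ x in (0 : ℝ)..1, k x ^ 2 := by
  have hθ := h.continuous_angle
  have hk := h.continuous_curv
  have hd : ∀ x ∈ I01, HasDerivWithinAt (fun x => k x * (θ x - Real.pi))
      (c * (Real.sin (θ x) * (θ x - Real.pi)) + k x ^ 2) I01 x := fun x hx => by
    refine ((h.curv_deriv x hx).mul ((h.angle_deriv x hx).sub_const Real.pi)).congr_deriv ?_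
    ring
  have := integral_eq_sub_of_hasDerivWithinAt hd (by fun_prop) 1 (by simp)
  rw [intervalIntegral.integral_add (Continuous.intervalIntegrable (by fun_prop) _ _)
    (Continuous.intervalIntegrable (by fun_prop) _ _), intervalIntegral.integral_const_mul,
    h.curv_zero, h.curv_one] at this
  linarith

theorem integral_cos_mul_curv (h : IsLoopPendulum ℓ c θ k) :
    ∫ x in (0 : ℝ)..1, Real.cos (θ x) * k x = Real.sin (θ 1) - Real.sin (θ 0) := by
  have hθ := h.continuous_angle
  have hk := h.continuous_curv
  exact integral_eq_sub_of_hasDerivWithinAt (fun x hx => (h.angle_deriv x hx).sin)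
    (by fun_prop) 1 (by simp)

/-- The linearized elastica equation, tested with the curvature. -/
theorem integral_jacobi (h : IsLoopPendulum ℓ c θ k) :
    ∫ x in (0 : ℝ)..1, (c * Real.sin (θ x)) ^ 2 =
      -(c * ∫ x in (0 : ℝ)..1, Real.cos (θ x) * k x ^ 2) := by
  have hθ := h.continuous_angle
  have hk := h.continuous_curv
  have hd : ∀ x ∈ I01, HasDerivWithinAt (fun x => k x * (c * Real.sin (θ x)))
      ((c * Real.sin (θ x)) ^ 2 + c * (Real.cos (θ x) * k x ^ 2)) I01 x := fun x hx => by
    refine ((h.curv_deriv x hx).mul ((h.angle_deriv x hx).sin.const_mul c)).congr_deriv ?_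
    ring
  have := integral_eq_sub_of_hasDerivWithinAt hd (by fun_prop) 1 (by simp)
  rw [intervalIntegral.integral_add (Continuous.intervalIntegrable (by fun_prop) _ _)
    (Continuous.intervalIntegrable (by fun_prop) _ _), intervalIntegral.integral_const_mul,
    h.curv_zero, h.curv_one] at this
  linarith

/-- The second variation of the bending energy at the loop is negative in the direction of
`regCurv η k`, for small `η`. -/
theorem exists_unstable (h : IsLoopPendulum ℓ c θ k) (hℓ : ℓ ∈ Set.Ioo (0 : ℝ) 1) :
    ∃ η > 0, ℓ * ((∫ x in (0 : ℝ)..1, (k x * (c * Real.sin (θ x)) / regCurv η k x) ^ 2) +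
        c * ∫ x in (0 : ℝ)..1, Real.cos (θ x) * regCurv η k x ^ 2) <
      c * (∫ x in (0 : ℝ)..1, Real.cos (θ x) * regCurv η k x) ^ 2 := by
  have hθ := h.continuous_angle
  have hk := h.continuous_curv
  have hpi := Real.pi_pos
  have hs0 : 0 < Real.sin (θ 0) :=
    Real.sin_pos_of_pos_of_lt_pi h.angle_zero.1 (by linarith [h.angle_zero.2])
  have hs1 : Real.sin (θ 1) < 0 := by
    have := Real.sin_pos_of_pos_of_lt_pi (x := 2 * Real.pi - θ 1)
      (by linarith [h.angle_one.2]) (by linarith [h.angle_one.1])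
    rw [Real.sin_two_pi_sub] at this
    linarith
  set S := Real.sin (θ 0) - Real.sin (θ 1) with hS
  have hη : 0 < S / 2 := by linarith
  refine ⟨S / 2, hη, ?_⟩
  set η := S / 2
  have hφ := h.continuous_regCurv (η := η)
  have hφ₁ := h.continuous_regCurv_deriv hη
  -- The factor `k² / (k² + η²)` is at most `1`.
  have hP : ∫ x in (0 : ℝ)..1, (k x * (c * Real.sin (θ x)) / regCurv η k x) ^ 2 ≤
      ∫ x in (0 : ℝ)..1, (c * Real.sin (θ x)) ^ 2 := by
    refine intervalIntegral.integral_mono_on zero_le_one ((hφ₁.pow 2).intervalIntegrable _ _)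
      (Continuous.intervalIntegrable (by fun_prop) _ _) fun x _ => ?_
    have hp : 0 < regCurv η k x := hη.trans_le (le_regCurv η k x)
    rw [div_pow, mul_pow, div_le_iff₀ (by positivity), mul_comm, regCurv_sq]
    exact mul_le_mul_of_nonneg_left (by linarith [sq_nonneg η]) (sq_nonneg _)
  have hA : ∫ x in (0 : ℝ)..1, Real.cos (θ x) * regCurv η k x ^ 2 =
      (∫ x in (0 : ℝ)..1, Real.cos (θ x) * k x ^ 2) + η ^ 2 * ℓ := by
    rw [← h.integral_cos, ← intervalIntegral.integral_const_mul, ← intervalIntegral.integral_add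
      (Continuous.intervalIntegrable (by fun_prop) _ _)
      (Continuous.intervalIntegrable (by fun_prop) _ _)]
    refine intervalIntegral.integral_congr fun x _ => ?_
    simp only [regCurv_sq]
    ring
  -- The drift along `k` is `-S = -2η`, and replacing `k` by `regCurv η k` costs at most `η`.
  have hM : ∫ x in (0 : ℝ)..1, Real.cos (θ x) * regCurv η k x ≤ -η := by
    have hd : |∫ x in (0 : ℝ)..1, Real.cos (θ x) * (regCurv η k x - k x)| ≤ η := by
      refine abs_integral_le_of_forall_abs_le fun x hx => ?_
      rw [abs_mul]
      have := mul_le_mul (Real.abs_cos_le_one (θ x))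
        (abs_regCurv_sub_le hη.le (h.curv_nonneg hx)) (abs_nonneg _) zero_le_one
      linarith
    simp only [mul_sub] at hd
    rw [intervalIntegral.integral_sub (Continuous.intervalIntegrable (by fun_prop) _ _)
      (Continuous.intervalIntegrable (by fun_prop) _ _), h.integral_cos_mul_curv] at hd
    have := (abs_le.1 hd).2
    simp only [η] at this ⊢
    linarith
  rw [hA]
  rw [h.integral_jacobi] at hP
  have hM2 : η ^ 2 ≤ (∫ x in (0 : ℝ)..1, Real.cos (θ x) * regCurv η k x) ^ 2 := by nlinarith
  have h1 := mul_le_mul_of_nonneg_left hP hℓ.1.le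
  have h2 := mul_le_mul_of_nonneg_left hM2 h.c_pos.le
  -- By `integral_jacobi` only `c ℓ² η²` survives on the left, against at least `c η²` on the right;
  -- `ℓ < 1` decides.
  have h3 : ℓ * ℓ * (c * η ^ 2) < 1 * (c * η ^ 2) := by
    refine mul_lt_mul_of_pos_right ?_ (mul_pos h.c_pos (by positivity))
    nlinarith [hℓ.1, hℓ.2]
  nlinarith

end IsLoopPendulum

/-! ### The deformation and the competitor -/

/-- The deformation of the direction `θ` that shrinks it towards `π` and moves it along `φ`. -/
def deformAngle (θ φ : ℝ → ℝ) (ε t x : ℝ) : ℝ := Real.pi + t * (θ x - Real.pi) + ε * φ x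

/-- The horizontal component of the chord of the deformed curve. -/
def chordX (θ φ : ℝ → ℝ) (p : ℝ × ℝ) : ℝ := ∫ x in (0 : ℝ)..1, Real.cos (deformAngle θ φ p.1 p.2 x)

/-- The vertical component of the chord of the deformed curve. -/
def chordY (θ φ : ℝ → ℝ) (p : ℝ × ℝ) : ℝ := ∫ x in (0 : ℝ)..1, Real.sin (deformAngle θ φ p.1 p.2 x)

theorem continuous_chordX {θ φ : ℝ → ℝ} (hθ : Continuous θ) (hφ : Continuous φ) :
    Continuous (chordX θ φ) := by
  refine intervalIntegral.continuous_parametric_intervalIntegral_of_continuous' ?_ _ _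
  simp only [Function.uncurry_def, deformAngle]
  fun_prop

theorem continuous_chordY {θ φ : ℝ → ℝ} (hθ : Continuous θ) (hφ : Continuous φ) :
    Continuous (chordY θ φ) := by
  refine intervalIntegral.continuous_parametric_intervalIntegral_of_continuous' ?_ _ _
  simp only [Function.uncurry_def, deformAngle]
  fun_prop

theorem continuous_sqChord_deformAngle {θ φ : ℝ → ℝ} (hθ : Continuous θ) (hφ : Continuous φ) :
    Continuous fun p : ℝ × ℝ => sqChord (deformAngle θ φ p.1 p.2) :=
  ((continuous_chordX hθ hφ).pow 2).add ((continuous_chordY hθ hφ).pow 2)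

/-- Turning a curve so that its chord becomes horizontal. -/
theorem integral_rotate {ψ : ℝ → ℝ} (hψ : Continuous ψ) {ℓ : ℝ} (hℓ : 0 < ℓ)
    (hX : 0 < ∫ x in (0 : ℝ)..1, Real.cos (ψ x)) (hD : sqChord ψ = ℓ ^ 2) :
    (∫ x in (0 : ℝ)..1,
      Real.cos (ψ x - Real.arcsin ((∫ x in (0 : ℝ)..1, Real.sin (ψ x)) / ℓ))) = ℓ ∧
    (∫ x in (0 : ℝ)..1,
      Real.sin (ψ x - Real.arcsin ((∫ x in (0 : ℝ)..1, Real.sin (ψ x)) / ℓ))) = 0 := by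
  rw [sqChord] at hD
  set X := ∫ x in (0 : ℝ)..1, Real.cos (ψ x) with hXdef
  set Y := ∫ x in (0 : ℝ)..1, Real.sin (ψ x) with hYdef
  have hY : |Y / ℓ| ≤ 1 := by
    rw [abs_div, abs_of_pos hℓ, div_le_one hℓ]
    exact abs_le_of_sq_le_sq (by nlinarith) hℓ.le
  have hsin : Real.sin (Real.arcsin (Y / ℓ)) = Y / ℓ :=
    Real.sin_arcsin (abs_le.1 hY).1 (abs_le.1 hY).2
  -- Positivity of `X` selects the right sign of the cosine.
  have hcos : Real.cos (Real.arcsin (Y / ℓ)) = X / ℓ := by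
    rw [Real.cos_arcsin, Real.sqrt_eq_iff_mul_self_eq_of_pos (div_pos hX hℓ)]
    field_simp
    linarith
  simp only [Real.cos_sub, Real.sin_sub, hsin, hcos]
  have i1 : IntervalIntegrable (fun x => Real.cos (ψ x)) MeasureTheory.volume 0 1 :=
    Continuous.intervalIntegrable (by fun_prop) _ _
  have i2 : IntervalIntegrable (fun x => Real.sin (ψ x)) MeasureTheory.volume 0 1 :=
    Continuous.intervalIntegrable (by fun_prop) _ _
  rw [intervalIntegral.integral_add (i1.mul_const _) (i2.mul_const _),
    intervalIntegral.integral_sub (i2.mul_const _) (i1.mul_const _)]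
  simp only [intervalIntegral.integral_mul_const, ← hXdef, ← hYdef]
  constructor
  · field_simp
    linarith
  · ring

/-- The conditions on the parameters that make the deformed and turned curve well-prepared. -/
def IsGoodParam (ℓ c η : ℝ) (θ φ : ℝ → ℝ) (p : ℝ × ℝ) : Prop :=
  0 < chordX θ φ p ∧ p.1 * (c / η) < p.2 ∧
  deformAngle θ φ p.1 p.2 0 - Real.arcsin (chordY θ φ p / ℓ) ∈ Set.Ioo 0 (Real.pi / 2) ∧
  deformAngle θ φ p.1 p.2 1 - Real.arcsin (chordY θ φ p / ℓ) ∈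
    Set.Ioo (3 * Real.pi / 2) (2 * Real.pi)

namespace IsLoopPendulum

variable {ℓ c η : ℝ} {θ k : ℝ → ℝ}

/-- At `(0, 1)` the deformed curve is the loop itself, which satisfies all these strict
inequalities; they persist by continuity. -/
theorem eventually_isGoodParam (h : IsLoopPendulum ℓ c θ k) (hℓ : 0 < ℓ) {φ : ℝ → ℝ}
    (hφ : Continuous φ) : ∀ᶠ p in nhds ((0, 1) : ℝ × ℝ), IsGoodParam ℓ c η θ φ p := by
  have hX := continuous_chordX h.continuous_angle hφ
  have hY := continuous_chordY h.continuous_angle hφ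
  have hX0 : chordX θ φ (0, 1) = ℓ := by
    rw [← h.integral_cos]; simp [chordX, deformAngle]
  have hY0 : chordY θ φ (0, 1) = 0 := by
    simpa [chordY, deformAngle] using h.integral_sin
  have hA : ∀ x, Continuous fun p : ℝ × ℝ =>
      deformAngle θ φ p.1 p.2 x - Real.arcsin (chordY θ φ p / ℓ) := fun x => by
    have := Real.continuous_arcsin.comp (hY.div_const ℓ)
    unfold deformAngle
    fun_prop
  have hA0 : ∀ x, deformAngle θ φ 0 1 x - Real.arcsin (chordY θ φ (0, 1) / ℓ) = θ x := fun x => by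
    simp [hY0, deformAngle]
  refine Filter.Eventually.and ?_ (Filter.Eventually.and ?_ (Filter.Eventually.and ?_ ?_))
  · exact hX.continuousAt.eventually (lt_mem_nhds (by rwa [hX0]))
  · exact (isOpen_lt (by fun_prop) (by fun_prop)).mem_nhds (by simp)
  · exact (hA 0).continuousAt.eventually
      (isOpen_Ioo.mem_nhds (by simpa only [hA0] using h.angle_zero))
  · exact (hA 1).continuousAt.eventually
      (isOpen_Ioo.mem_nhds (by simpa only [hA0] using h.angle_one))

theorem exists_param (h : IsLoopPendulum ℓ c θ k) (hℓ : ℓ ∈ Set.Ioo (0 : ℝ) 1) :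
    ∃ η ε t, 0 < η ∧ 0 < ε ∧ IsGoodParam ℓ c η θ (regCurv η k) (ε, t) ∧
      sqChord (deformAngle θ (regCurv η k) ε t) = ℓ ^ 2 ∧
      t ^ 2 * (∫ x in (0 : ℝ)..1, k x ^ 2) +
        ε ^ 2 * (∫ x in (0 : ℝ)..1, (k x * (c * Real.sin (θ x)) / regCurv η k x) ^ 2) <
          ∫ x in (0 : ℝ)..1, k x ^ 2 := by
  obtain ⟨η, hη, hlt⟩ := h.exists_unstable hℓ
  have hθ := h.continuous_angle
  have hφ := h.continuous_regCurv (η := η)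
  have hℓ0 := hℓ.1
  have hc := h.c_pos
  have hB := h.energy_pos
  have hsinang := h.integral_sin_mul_angle
  set φ := regCurv η k
  set B := ∫ x in (0 : ℝ)..1, k x ^ 2
  set P := ∫ x in (0 : ℝ)..1, (k x * (c * Real.sin (θ x)) / φ x) ^ 2
  set A := ∫ x in (0 : ℝ)..1, Real.cos (θ x) * φ x ^ 2
  set M := ∫ x in (0 : ℝ)..1, Real.cos (θ x) * φ x
  have hP : 0 ≤ P := intervalIntegral.integral_nonneg zero_le_one fun x _ => sq_nonneg _
  have hang : ∫ x in (0 : ℝ)..1, Real.sin (θ x) * (Real.pi - θ x) = B / c := by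
    have e : ∀ x, Real.sin (θ x) * (Real.pi - θ x) = -(Real.sin (θ x) * (θ x - Real.pi)) :=
      fun x => by ring
    simp only [e, intervalIntegral.integral_neg]
    rw [eq_div_iff hc.ne']
    linarith
  -- `P < 2σB` lowers the energy and the other bound lengthens the chord when `t = 1 - σ ε²`.
  -- Instability says exactly that the two are compatible; `2σB` is the midpoint of its allowed
  -- range.
  obtain ⟨σ, hσ, hσP, hσM⟩ : ∃ σ, 0 < σ ∧ P < 2 * σ * B ∧ ℓ * (2 * σ * B + c * A) < c * M ^ 2 := by
    set g := c * M ^ 2 - ℓ * (P + c * A) with hg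
    have hg0 : 0 < g := by linarith
    have e : 2 * ((P + g / (2 * ℓ)) / (2 * B)) * B = P + g / (2 * ℓ) := by field_simp
    have e2 : ℓ * (g / (2 * ℓ)) = g / 2 := by field_simp
    refine ⟨(P + g / (2 * ℓ)) / (2 * B), by positivity, ?_, ?_⟩
    · rw [e]
      have : 0 < g / (2 * ℓ) := by positivity
      linarith
    · rw [e]
      nlinarith
  obtain ⟨δ, hδ, hgood⟩ := Metric.eventually_nhds_iff.1
    (h.eventually_isGoodParam (η := η) hℓ0 hφ)
  have hshrink : ∀ᶠ τ in nhdsWithin (0 : ℝ) (Set.Ioi 0),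
      sqChord (deformAngle θ φ 0 (1 - τ)) < ℓ ^ 2 := by
    have := eventually_sqChord_lt (a := fun x => Real.pi - θ x) hℓ0 hθ (by fun_prop)
      h.integral_cos h.integral_sin (by rw [hang]; positivity)
    refine this.mono fun τ hτ => ?_
    convert hτ using 2
    funext x
    simp only [deformAngle]
    ring
  obtain ⟨τ, hτ, hτδ, hτ0⟩ := (hshrink.and
    ((eventually_pos_of_continuous (f := fun τ => δ - τ) (by fun_prop) (by simpa)).and
      self_mem_nhdsWithin)).exists
  replace hτ0 : 0 < τ := hτ0
  have hgrow : ∀ᶠ ε in nhdsWithin (0 : ℝ) (Set.Ioi 0),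
      ℓ ^ 2 < sqChord (deformAngle θ φ ε (1 - σ * ε ^ 2)) := by
    have := eventually_lt_sqChord (a := φ) (b := fun x => σ * (Real.pi - θ x)) hℓ0 hθ hφ
      (by fun_prop) h.integral_cos h.integral_sin h.integral_sin_mul_regCurv (by
        have e : ∀ x, Real.sin (θ x) * (σ * (Real.pi - θ x)) + Real.cos (θ x) * φ x ^ 2 / 2 =
          σ * (Real.sin (θ x) * (Real.pi - θ x)) + 1 / 2 * (Real.cos (θ x) * φ x ^ 2) :=
          fun x => by ring
        simp only [e]
        rw [intervalIntegral.integral_add (Continuous.intervalIntegrable (by fun_prop) _ _)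
          (Continuous.intervalIntegrable (by fun_prop) _ _),
          intervalIntegral.integral_const_mul, intervalIntegral.integral_const_mul, hang]
        have e2 : 2 * ℓ * (σ * (B / c) + 1 / 2 * A) = ℓ * (2 * σ * B + c * A) / c := by
          field_simp
        rw [e2, div_lt_iff₀ hc]
        linarith)
    refine this.mono fun ε hε => ?_
    convert hε using 2
    funext x
    simp only [deformAngle]
    ring
  have hD := continuous_sqChord_deformAngle hθ hφ
  -- `τ` is fixed first, with a chord too short at `ε = 0`; this persists at `t = 1 - τ` for small
  -- `ε`, while at `t = 1 - σ ε²` the chord is too long.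
  obtain ⟨ε, hε1, hε2, hε3, hε4, hε5, hε0⟩ := (hgrow.and
    ((eventually_pos_of_continuous
      (f := fun ε => ℓ ^ 2 - sqChord (deformAngle θ φ ε (1 - τ)))
      (continuous_const.sub (hD.comp (by fun_prop : Continuous fun ε : ℝ => (ε, 1 - τ))))
      (by simpa using hτ)).and
    ((eventually_pos_of_continuous (f := fun ε => δ - ε) (by fun_prop) (by simpa)).and
    ((eventually_pos_of_continuous (f := fun ε => τ - σ * ε ^ 2) (by fun_prop) (by simpa)).and
    ((eventually_pos_of_continuous (f := fun ε => 2 * σ * B - P - σ ^ 2 * ε ^ 2 * B)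
      (by fun_prop) (by simpa)).and self_mem_nhdsWithin))))).exists
  replace hε0 : 0 < ε := hε0
  obtain ⟨t, ht, htD⟩ := intermediate_value_Ioo (by linarith : 1 - τ ≤ 1 - σ * ε ^ 2)
    (hD.comp (by fun_prop : Continuous fun t : ℝ => (ε, t))).continuousOn
    (show ℓ ^ 2 ∈ Set.Ioo _ _ from ⟨by simpa using hε2, by simpa using hε1⟩)
  have hσε : 0 < σ * ε ^ 2 := by positivity
  have hgp : IsGoodParam ℓ c η θ φ (ε, t) := by
    refine hgood ?_
    rw [Prod.dist_eq, max_lt_iff, Real.dist_eq, Real.dist_eq, abs_lt, abs_lt]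
    refine ⟨⟨?_, ?_⟩, ⟨?_, ?_⟩⟩ <;> simp only <;> linarith [ht.1, ht.2]
  refine ⟨η, ε, t, hη, hε0, hgp, htD, ?_⟩
  have ht0 : 0 < t := lt_of_le_of_lt (by positivity) hgp.2.1
  -- The `t` found is below `1 - σ ε²`, so the energy is below `B - ε² (2σB - P - σ² ε² B)`.
  have ht2 : t ^ 2 ≤ (1 - σ * ε ^ 2) ^ 2 := pow_le_pow_left₀ ht0.le ht.2.le 2
  have hlt2 := mul_le_mul_of_nonneg_right ht2 hB.le
  nlinarith [mul_pos (pow_pos hε0 2) hε5]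

/-- A direction with smaller bending energy than the loop elastica. -/
theorem exists_competitor (h : IsLoopPendulum ℓ c θ k) (hℓ : ℓ ∈ Set.Ioo (0 : ℝ) 1) :
    ∃ θ' k' : ℝ → ℝ, ContDiffOn ℝ ∞ θ' I01 ∧ ContinuousOn k' I01 ∧
      (∀ x ∈ I01, HasDerivWithinAt θ' (k' x) I01 x) ∧ k' 0 = 0 ∧ k' 1 = 0 ∧
      (∀ x ∈ Set.Ioo (0 : ℝ) 1, 0 < k' x) ∧ θ' 0 ∈ Set.Ioo 0 (Real.pi / 2) ∧
      θ' 1 ∈ Set.Ioo (3 * Real.pi / 2) (2 * Real.pi) ∧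
      (∫ x in (0 : ℝ)..1, Real.cos (θ' x)) = ℓ ∧ (∫ x in (0 : ℝ)..1, Real.sin (θ' x)) = 0 ∧
      ∫ x in (0 : ℝ)..1, k' x ^ 2 < ∫ x in (0 : ℝ)..1, k x ^ 2 := by
  obtain ⟨η, ε, t, hη, hε, ⟨hX, ht, h0, h1⟩, hD, hlt⟩ := h.exists_param hℓ
  have hθ := h.continuous_angle
  have hk := h.continuous_curv
  have hφ := h.continuous_regCurv (η := η)
  have hφ₁ := h.continuous_regCurv_deriv hη
  have hcross := h.integral_curv_mul_deriv_regCurv hη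
  simp only at ht h0 h1
  set ψ := deformAngle θ (regCurv η k) ε t with hψ
  have hψc : Continuous ψ := by
    simp only [hψ]
    unfold deformAngle
    fun_prop
  obtain ⟨hcos, hsin⟩ := integral_rotate hψc hℓ.1 hX hD
  set φ₁ : ℝ → ℝ := fun x => k x * (c * Real.sin (θ x)) / regCurv η k x with hφ₁def
  refine ⟨fun x => ψ x - Real.arcsin ((∫ x in (0 : ℝ)..1, Real.sin (ψ x)) / ℓ),
    fun x => t * k x + ε * φ₁ x, ?_, by fun_prop, fun x hx => ?_, ?_, ?_, fun x hx => ?_, h0, h1,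
    hcos, hsin, ?_⟩
  · refine ContDiffOn.sub (ContDiffOn.add (contDiffOn_const.add (contDiffOn_const.mul
      (h.smooth_angle.sub contDiffOn_const))) (contDiffOn_const.mul (h.contDiffOn_regCurv hη)))
      contDiffOn_const
  · exact (((((h.angle_deriv x hx).sub_const Real.pi).const_mul t).const_add Real.pi).add
      ((h.hasDerivWithinAt_regCurv hη hx).const_mul ε)).sub_const _
  · simp [hφ₁def, h.curv_zero]
  · simp [hφ₁def, h.curv_one]
  · have hkx := h.curv_pos x hx
    have hp : 0 < regCurv η k x := hη.trans_le (le_regCurv η k x)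
    have e : t * k x + ε * φ₁ x =
        k x * (t + ε * (c * Real.sin (θ x)) / regCurv η k x) := by
      simp only [hφ₁def]
      ring
    simp only [e]
    refine mul_pos hkx ?_
    -- The lower bound `η` of `regCurv` makes the relative change of curvature uniformly small, even
    -- at the ends where `k` vanishes; `ε c / η < t` then keeps the sign.
    have h2 : c * -Real.sin (θ x) / regCurv η k x ≤ c / η := by
      have hs : c * -Real.sin (θ x) ≤ c := by
        nlinarith [h.c_pos, Real.neg_one_le_sin (θ x)]
      exact div_le_div₀ h.c_pos.le hs hη (le_regCurv η k x)
    have h3 := mul_le_mul_of_nonneg_left h2 hε.le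
    have e2 : ε * (c * -Real.sin (θ x) / regCurv η k x) =
        -(ε * (c * Real.sin (θ x)) / regCurv η k x) := by ring
    linarith
  · have e : ∀ x, (t * k x + ε * φ₁ x) ^ 2 =
        t ^ 2 * k x ^ 2 + 2 * t * ε * (k x * φ₁ x) + ε ^ 2 * φ₁ x ^ 2 := fun x => by ring
    simp only [e]
    rw [intervalIntegral.integral_add (Continuous.intervalIntegrable (by fun_prop) _ _)
      (Continuous.intervalIntegrable (by fun_prop) _ _), intervalIntegral.integral_add
      (Continuous.intervalIntegrable (by fun_prop) _ _)
      (Continuous.intervalIntegrable (by fun_prop) _ _), intervalIntegral.integral_const_mul,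
      intervalIntegral.integral_const_mul, intervalIntegral.integral_const_mul, hcross]
    linarith

end IsLoopPendulum

end ElasticCurve

end

theorem lemma2p10 (ℓ : ℝ) (hℓ : ℓ ∈ Set.Ioo (0 : ℝ) 1) :
    (∃ γloop : ℝ → ElasticCurve.Plane, ElasticCurve.IsUpperLoop ℓ γloop) ∧
    ∀ γloop : ℝ → ElasticCurve.Plane, ElasticCurve.IsUpperLoop ℓ γloop →
      ∃ (γ : ℝ → ElasticCurve.Plane) (θ : ℝ → ℝ),
        ElasticCurve.IsSmoothAdmissible ℓ γ ∧
        ElasticCurve.IsTangentAngle γ θ ∧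
        ElasticCurve.signedCurvature γ θ 0 = 0 ∧
        ElasticCurve.signedCurvature γ θ 1 = 0 ∧
        Set.MapsTo γ (Set.Ioo 0 1) ElasticCurve.upperHalf ∧
        θ 0 ∈ Set.Ioo 0 (Real.pi / 2) ∧
        θ 1 ∈ Set.Ioo (3 * Real.pi / 2) (2 * Real.pi) ∧
        ElasticCurve.bendingEnergy γ < ElasticCurve.bendingEnergy γloop ∧
        0 < ElasticCurve.totalCurvature γ θ := by
  refine ⟨ElasticCurve.exists_isUpperLoop hℓ, fun γloop hloop => ?_⟩
  obtain ⟨c, θ₀, k₀, h, hE⟩ := hloop.exists_isLoopPendulum hℓ.1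
  obtain ⟨θ, k, hs, hkc, hd, hk0, hk1, hpos, h0, h1, hcos, hsin, hlt⟩ := h.exists_competitor hℓ
  have hdir := ElasticCurve.hasDirection_curveOfAngle hs.continuousOn
  refine ⟨ElasticCurve.curveOfAngle θ, θ,
    ElasticCurve.isSmoothAdmissible_curveOfAngle hs hcos hsin,
    hdir.isTangentAngle hs.continuousOn, ?_, ?_, fun x hx => ?_, h0, h1, ?_, ?_⟩
  · rw [hdir.signedCurvature_eq hd (by simp), hk0]
  · rw [hdir.signedCurvature_eq hd (by simp), hk1]
  · change 0 < ElasticCurve.curveOfAngle θ x 1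
    rw [ElasticCurve.curveOfAngle_apply_one hs.continuousOn ⟨hx.1.le, hx.2.le⟩]
    exact ElasticCurve.integral_sin_pos hs.continuousOn
      (ElasticCurve.strictMonoOn_of_hasDerivWithinAt_pos hd hpos) h0.1.le h1.2.le hsin hx
  · rw [hE, hdir.bendingEnergy_eq hd]
    exact hlt
  · rw [hdir.totalCurvature_eq hd hkc]
    linarith [h0.2, h1.1, Real.pi_pos]
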